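/- **Setting.** Let $J,\mathsf K$ be natural numbers and $\mathcal S_{\mathsf K}=\{s\in\mathbb Z_{\ge0}^J:\sum_j s_j\le\mathsf K\}$ the set of schedules. For every non-empty schedule $s$ let $N(s)\ge 1$ be the codeword length of one of the following three systems, with message alphabet sizes $M_j\ge2$ and a parameter $0\le\rho\le1$; the block lengths below are assumed to exist. (a) *Multiaccess channel, joint maximum-likelihood decoding, messages of a source encoded jointly.* There are $J$ sources with finite input alphabets $\mathcal X_j$ and input distributions $Q_j$, a finite output alphabet $\mathcal Y$ and transition probabilities $p(y|x_1\dots x_J)$. For a set $S$ of sources let $$E_{o,S}(\rho,Q)=-\ln\sum_{x(S^c)}Q_{S^c}(x(S^c))\sum_y\Big[\sum_{x(S)}Q_S(x(S))\,p(y|x)^{\frac1{1+\rho}}\Big]^{1+\rho},$$ where $S^c$ is the complement in the set of all sources. $N(s)$ is the smallest positive integer $n$ with $\sum_{\emptyset\ne S\subseteq T}\exp\big(-n[-\rho\sum_{j\in S}R_j+E_{o,S}(\rho,Q)]\big)\le p_e$, where $p_e>0$, $T=\{j:s_j>0\}$ and $R_j=s_j\ln M_j/n$. (b) *The same with each message encoded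 separately.* The sources are the pairs $(j,k)$ with $1\le j\le J$, $1\le k\le\mathsf K$, and now $T=\{(j,k):k\le s_j\}$ and $R_{(j,k)}=\ln M_j/n$. (c) *Degraded broadcast channel with $J$ receivers and superposition encoding.* There are a channel from $\mathcal X_1$ to $(Y_1,\dots,Y_J)$, degraded in the order $Y_1\to Y_2\to\dots\to Y_J$, and conditional distributions $Q_J(x_J)$, $Q_j(x_j|x_{j+1})$ on finite alphabets; $p'_{Y_j|X_k}$ is the induced channel from $x_k$ to $y_j$, and $$E_{o,X_k,Y_j}(\rho)=-\ln\sum_{x_{k+1}^J}Q_{k+1}^J(x_{k+1}^J)\sum_{y_j}\Big(\sum_{x_k}Q_k(x_k|x_{k+1})\,p'_{Y_j|X_k}(y_j|x_k)^{\frac1{1+\rho}}\Big)^{1+\rho}$$ (for $k=J$ there is no conditioning). $N(s)=\max\{N_j(s):s_j>0\}$, where $N_j(s)$ is the smallest positive integer $n$ with $\sum_{k=j}^J\exp\big(-n[E_{o,X_k,Y_j}(\rho)-\rho s_k\ln M_k/n]\big)\le p_{ej}$, and $p_{ej}>0$. **Queueing model.** In each time-slot $A_j$ class-$j$ messages arrive;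 the $A_j$ are independent of each other and i.i.d. over time, with mean $\mathbb EA_j$ and finite second moment. Each class-$j$ message is independently assigned, with probability $\mu_{js}$, to a subclass $(j,s)$, where $s\in\mathcal S_{\mathsf K}$, $s_j>0$; it then has service requirement $N(s)$ and joins the end of the queue $(j,s)$. Put $\mathbb EA_{js}=\mu_{js}\mathbb EA_j$. A state $\alpha$ lists the residual service requirements $x_{js}(k)$ of the messages in all queues, with at most one ongoing transmission per schedule: the messages of $s$ with residual requirement less than $N(s)$ stand at the heads of the queues $(j,s)$, at most $s_j$ of them in queue $(j,s)$, and have a common residual requirement. A state-independent policy is a probability distribution $p^\omega$ on $\mathcal S_{\mathsf K}$. In each slot a schedule $s$ is drawn from $p^\omega$; if a transmission of $s$ is ongoing, then each of its messages receives one unit of service, otherwise the first $\min\{s_j,n_{js}(\alpha)\}$ messages of each queue $(j,s)$ do, where $n_{js}(\alpha)$ is the length of queue $(j,s)$. Messages with residual requirement $0$ leave, and then the new messages are admitted. Subclasses with $p^\omega(s)=\mu_{js}=0$ are *not in use*; their queues are empty in all states. The chain is *stable* if it is positive recurrent (some state is reached in finite mean time from every initial state, itself included; irreducibility is not presupposed)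 and the number of messages has finite stationary mean. It is *unstable* if every state is transient. It is *$c$-regular*, for a function $c\ge 1$ of the state, if for some state $\alpha_0$ the mean of $\sum_{0\le n<\tau_{\alpha_0}}c(X_n)$ is finite from every initial state, $\tau_{\alpha_0}$ being the first passage time to $\alpha_0$. Put $r_j(s)=s_j/N(s)$ if $s_j>0$ and $r_j(s)=0$ otherwise, and let $\mathcal R_{out}\subset\mathbb R_+^J$ be the convex hull of $\{r(s):s\in\mathcal S_{\mathsf K}\}$. The policy $p^\omega$ has the splitting probabilities $\mu^\omega_{js}=p^\omega(s)r_j(s)/\sum_{s'}p^\omega(s')r_j(s')$. Let $\mathcal R^\omega$ be the set of $\lambda\in\mathbb R_+^J$ such that $\mu^\omega$ is well defined (no denominator vanishes) and the chain with policy $p^\omega$ and splitting $\mu^\omega$ is stable for all arrival processes (as above) with $\mathbb EA=\lambda$. **Claim.** For each of the systems (a), (b), (c): 1. For every $p^\omega$, every splitting $\mu$ and all arrival processes, if $N(s)\,\mathbb EA_{js}<p^\omega(s)s_j$ for every subclass $(j,s)$ in use (in particular, if this holds for every subclass), then the chain is stable, and it is $c$-regular for $c(\alpha)=1+\sum_{j,s}h_{js}(\alpha)$,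 $h_{js}(\alpha)=N(s)\beta_{js}(\alpha)+s_jx_{js}(1)\mathbf 1\{n_{js}(\alpha)>\beta_{js}(\alpha)\}$, where $\beta_{js}(\alpha)$ is the number of messages in queue $(j,s)$ with residual requirement $N(s)$. 2. If $N(s)\,\mathbb EA_{js}>p^\omega(s)s_j$ for at least one subclass $(j,s)$, then the chain is unstable. 3. For every $p^\omega$, $\mathcal R^\omega=\{\lambda\in\mathbb R_+^J:\lambda_j<\sum_sp^\omega(s)r_j(s)\text{ for }1\le j\le J\}$. 4. $\bigcup_\omega\mathcal R^\omega=\mathcal R_{out}^o$, where the interior is taken in $\mathbb R_+^J$. 5. For every $\lambda\in\mathcal R_{out}^o$ there is a state-independent policy $p^\omega$ such that the chain with policy $p^\omega$ and splitting $\mu^\omega$ is stable for all arrival processes with $\mathbb EA=\lambda$. -/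

import Mathlib

open scoped NNReal ENNReal

/-! ### Discrete-time Markov chains on a countable set -/

section MarkovChain

variable {X : Type*}

/-- The law of `X_n` for the chain with transition law `P` started at `x`. -/
noncomputable def stepLaw (P : X → PMF X) (x : X) : ℕ → PMF X
  | 0 => PMF.pure x
  | n + 1 => (stepLaw P x n).bind P

open Classical in
/-- `tabooCost P c y n x = E_x [c(X_n) ; n < τ_y]`, where `τ_y = min {n ≥ 1 : X_n = y}` is the first
passage time to `y`. -/
noncomputable def tabooCost (P : X → PMF X) (c : X → ℝ≥0∞) (y : X) : ℕ → X → ℝ≥0∞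
  | 0, x => c x
  | n + 1, x => ∑' x', P x x' * (if x' = y then 0 else tabooCost P c y n x')

/-- `E_x [∑_{n < τ_y} c(X_n)]`; for `c = 1` this is the mean first passage time `E_x [τ_y]`. -/
noncomputable def expectedCost (P : X → PMF X) (c : X → ℝ≥0∞) (x y : X) : ℝ≥0∞ :=
  ∑' n, tabooCost P c y n x

/-- The chain on the closed set of states `S` is `c`-regular: there is a state `y` such that the mean
`c`-cost accumulated until the first passage to `y` is finite from every initial state. No
irreducibility is presupposed (transient states are allowed). -/
def IsCRegularOn (P : X → PMF X) (S : Set X) (c : X → ℝ≥0∞) : Prop :=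
  ∃ y ∈ S, ∀ x ∈ S, expectedCost P c x y < ∞

/-- The chain on `S` is positive (Harris) recurrent: there is a state `y` whose mean first passage
time is finite from every initial state, `y` itself included. So there is exactly one recurrent
class, it is positive recurrent, and it is reached in finite mean time from everywhere. -/
def IsPositiveRecurrentOn (P : X → PMF X) (S : Set X) : Prop :=
  IsCRegularOn P S fun _ => 1

/-- Stability: positive recurrence together with a finite stationary mean of `num`. -/
def IsStableOn (P : X → PMF X) (S : Set X) (num : X → ℕ) : Prop :=
  IsPositiveRecurrentOn P S ∧
    ∃ π : PMF X, π.support ⊆ S ∧ π.bind P = π ∧ ∑' x, π x * (num x : ℝ≥0∞) < ∞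

/-- Transience (instability): from every state, the mean number of visits to that state is finite. -/
def IsTransientOn (P : X → PMF X) (S : Set X) : Prop :=
  ∀ x ∈ S, ∑' n, stepLaw P x n x < ∞

end MarkovChain

/-! ### Products and random splitting of probability laws -/

/-- The joint law of independent random variables with laws `q 0, …, q (J - 1)`. -/
noncomputable def indepLaw {β : Type*} : {J : ℕ} → (Fin J → PMF β) → PMF (Fin J → β)
  | 0, _ => PMF.pure fun i => i.elim0
  | _ + 1, q => (q 0).bind fun b => (indepLaw fun i => q i.succ).map fun f => Fin.cons b f

/-- The law of the vector of label counts when each of `n` customers independently receives a random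
label with law `μ`. -/
noncomputable def labelCounts {S : Type*} [DecidableEq S] (μ : PMF S) : ℕ → PMF (S → ℕ)
  | 0 => PMF.pure fun _ => 0
  | n + 1 => (labelCounts μ n).bind fun c => μ.map fun s => Function.update c s (c s + 1)

/-! ### The queueing model -/

/-- The schedules: vectors `s` of `J` non-negative integers with `∑ j, s j ≤ K`. -/
abbrev Sched (J K : ℕ) : Type := {s : Fin J → Fin (K + 1) // ∑ j, (s j : ℕ) ≤ K}

/-- The number `s_j` of class-`j` messages that `s` schedules. -/
def Sched.num {J K : ℕ} (s : Sched J K) (j : Fin J) : ℕ := (s.1 j : ℕ)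

/-- A state: for every pair `(j, s)` the list of residual service requirements of the messages in the
subclass queue `(j, s)`, head of the queue first. -/
abbrev QState (J K : ℕ) : Type := Fin J → Sched J K → List ℕ

section Queue

variable {J K : ℕ}

/-- The number of messages present in the system. -/
def numMessages (α : QState J K) : ℕ := ∑ j, ∑ s, (α j s).length

/-- The number `β_{js}(α)` of fresh messages, i.e. those not scheduled so far. -/
def fresh (N : Sched J K → ℕ) (α : QState J K) (j : Fin J) (s : Sched J K) : ℕ :=
  (α j s).countP fun x => x = N s

/-- The ongoing transmission `η(α, s)` of the schedule `s`. -/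
def ongoing (N : Sched J K → ℕ) (α : QState J K) (s : Sched J K) (j : Fin J) (t : Sched J K) : ℕ :=
  if t = s then (α j s).countP fun x => x < N s else 0

/-- The maximal schedule `z*(α, s)` of the schedule `s`. -/
def maximal (α : QState J K) (s : Sched J K) (j : Fin J) (t : Sched J K) : ℕ :=
  if t = s then min (s.num j) (α j s).length else 0

/-- The subclass schedule implemented in state `α` when the schedule `s` is drawn: the ongoing
transmission of `s` if there is one, and otherwise the maximal schedule of `s`. -/
def implemented (N : Sched J K → ℕ) (α : QState J K) (s : Sched J K) : Fin J → Sched J K → ℕ :=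
  if ∃ j t, ongoing N α s j t ≠ 0 then ongoing N α s else maximal α s

/-- One unit of service to the first `z` messages of a queue; messages whose residual requirement
reaches zero leave. -/
def serve (z : ℕ) (l : List ℕ) : List ℕ :=
  ((l.take z).map fun x => x - 1).filter (fun x => 0 < x) ++ l.drop z

/-- The next state: first the drawn schedule `s` is implemented, then the arrivals `a` (numbers of
new messages per subclass) are admitted, each with service requirement `N t`. -/
def nextState (N : Sched J K → ℕ) (α : QState J K) (s : Sched J K) (a : Fin J → Sched J K → ℕ) :
    QState J K :=
  fun j t => serve (implemented N α s j t) (α j t) ++ List.replicate (a j t) (N t)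

/-- The law of the numbers of new messages per subclass in a time-slot: the batch sizes `A j` are
independent, and each class-`j` message independently gets the subclass `(j, s)` with probability
`μ j s`. -/
noncomputable def arrivalLaw (A : Fin J → PMF ℕ) (μ : Fin J → PMF (Sched J K)) :
    PMF (Fin J → Sched J K → ℕ) :=
  indepLaw fun j => (A j).bind fun n => labelCounts (μ j) n

/-- The transition law of the queueing model under the state-independent policy `p`: a schedule is
drawn from `p`, independently of the state and of the arrivals. -/
noncomputable def queueChain (N : Sched J K → ℕ) (p : PMF (Sched J K)) (μ : Fin J → PMF (Sched J K))
    (A : Fin J → PMF ℕ) (α : QState J K) : PMF (QState J K) :=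
  p.bind fun s => (arrivalLaw A μ).map fun a => nextState N α s a

/-- `(j, s)` is a subclass if `s_j > 0`; it is in use unless its messages are never generated and `s`
is never drawn. -/
def InUse (p : PMF (Sched J K)) (μ : Fin J → PMF (Sched J K)) (j : Fin J) (s : Sched J K) : Prop :=
  0 < s.num j ∧ (p s ≠ 0 ∨ μ j s ≠ 0)

/-- The state space: only subclass queues in use hold messages, residual requirements are positive,
and for each schedule `s` there is at most one ongoing transmission: the messages of `s` that are not
fresh are at the heads of the queues `(j, s)`, at most `s_j` of them in the queue `(j, s)`, all with
the same residual requirement `r < N s`. -/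
def stateSpace (N : Sched J K → ℕ) (p : PMF (Sched J K)) (μ : Fin J → PMF (Sched J K)) :
    Set (QState J K) :=
  {α | (∀ j s, α j s ≠ [] → InUse p μ j s) ∧ (∀ j s, ∀ x ∈ α j s, 0 < x) ∧
    ∀ s, ∃ r, ∀ j, ∃ u ≤ s.num j, ∃ b, (u ≠ 0 → r < N s) ∧
      α j s = List.replicate u r ++ List.replicate b (N s)}

/-- `h_{js}(α) = N(s) β_{js}(α) + s_j x_{js}(1) 1{n_{js}(α) > β_{js}(α)}`. -/
def workload (N : Sched J K → ℕ) (α : QState J K) (j : Fin J) (s : Sched J K) : ℕ :=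
  N s * fresh N α j s +
    if fresh N α j s < (α j s).length then s.num j * (α j s).headD 0 else 0

/-- The cost function `c(α) = 1 + ∑_{js} h_{js}(α)`. -/
def queueCost (N : Sched J K → ℕ) (α : QState J K) : ℝ≥0∞ :=
  ((1 + ∑ j, ∑ s, workload N α j s : ℕ) : ℝ≥0∞)

/-- The batch-size laws `A j` have the means `lam j` and finite second moments. -/
def HasRates (A : Fin J → PMF ℕ) (lam : Fin J → ℝ≥0) : Prop :=
  ∀ j, ∑' k, A j k * (k : ℝ≥0∞) = lam j ∧ ∑' k, A j k * (k : ℝ≥0∞) ^ 2 < ∞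

/-- A splitting: class-`j` messages are only assigned to subclasses `(j, s)`, i.e. with `s_j > 0`. -/
def IsSplitting (μ : Fin J → PMF (Sched J K)) : Prop :=
  ∀ j s, μ j s ≠ 0 → 0 < s.num j

/-- The rate vector `r(s)`, `r_j(s) = s_j / N(s)` (which is `0` if `s_j = 0`). -/
noncomputable def rate (N : Sched J K → ℕ) (s : Sched J K) (j : Fin J) : ℝ :=
  (s.num j : ℝ) / (N s : ℝ)

/-- `∑_s p(s) r_j(s)`. -/
noncomputable def meanRate (N : Sched J K → ℕ) (p : PMF (Sched J K)) (j : Fin J) : ℝ :=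
  ∑ s, (p s).toReal * rate N s j

/-- `μ` is the splitting that belongs to the policy `p`:
`μ_{js} = p(s) r_j(s) / ∑_{s'} p(s') r_j(s')`. If a denominator vanishes (class `j` is never served)
then, the right-hand sides being zero, there is no such probability vector. -/
def IsPolicySplitting (N : Sched J K → ℕ) (p : PMF (Sched J K)) (μ : Fin J → PMF (Sched J K)) :
    Prop :=
  ∀ j s, (μ j s).toReal = (p s).toReal * rate N s j / meanRate N p j

/-- The stability region of the policy `p`: the arrival rate vectors such that the queueing model
under `p` is stable for all arrival processes with these rates. -/
def stabilityRegion (N : Sched J K → ℕ) (p : PMF (Sched J K)) : Set (Fin J → ℝ≥0) :=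
  {lam | ∃ μ : Fin J → PMF (Sched J K), IsPolicySplitting N p μ ∧
    ∀ A : Fin J → PMF ℕ, HasRates A lam →
      IsStableOn (queueChain N p μ A) (stateSpace N p μ) numMessages}

/-- The outer bound: the convex hull of the rate vectors, as a subset of the space of arrival rate
vectors, the non-negative orthant. -/
def outerRegion (N : Sched J K → ℕ) : Set (Fin J → ℝ≥0) :=
  {lam | (fun j => (lam j : ℝ)) ∈ convexHull ℝ (Set.range (rate N))}

end Queue

/-! ### Multiaccess channels with joint maximum-likelihood decoding -/

/-- A discrete memoryless multiaccess channel with sources indexed by `ι`, with finite input alphabets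
`X i`, finite output alphabet `Y`, transition probabilities `W`, and input distributions `Q i`. -/
structure MultiaccessChannel (ι : Type) where
  X : ι → Type
  Y : Type
  finX : ∀ i, Fintype (X i)
  finY : Fintype Y
  W : (∀ i, X i) → PMF Y
  Q : ∀ i, PMF (X i)

namespace MultiaccessChannel

variable {ι : Type} [Fintype ι] [DecidableEq ι] (C : MultiaccessChannel ι)

attribute [instance] MultiaccessChannel.finX MultiaccessChannel.finY

/-- The joint input `x` with the parts `x(S)` and `x(Sᶜ)`. -/
def joinInputs (S : Finset ι) (xS : ∀ i : {i // i ∈ S}, C.X i) (xc : ∀ i : {i // i ∉ S}, C.X i)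
    (i : ι) : C.X i :=
  if h : i ∈ S then xS ⟨i, h⟩ else xc ⟨i, h⟩

/-- `E_{o,S}(ρ, Q)`. -/
noncomputable def exponent (ρ : ℝ) (S : Finset ι) : ℝ :=
  -Real.log (∑ xc : ∀ i : {i // i ∉ S}, C.X i, (∏ i : {i // i ∉ S}, (C.Q i.1 (xc i)).toReal) *
    ∑ y : C.Y, (∑ xS : ∀ i : {i // i ∈ S}, C.X i, (∏ i : {i // i ∈ S}, (C.Q i.1 (xS i)).toReal) *
      (C.W (C.joinInputs S xS xc) y).toReal ^ (1 / (1 + ρ))) ^ (1 + ρ))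

/-- The random coding bound `χ(T, n)` on the joint decoding error probability with block length `n`
when exactly the sources in `T` carry messages and source `i ∈ T` has `exp (L i)` message values. -/
noncomputable def errorBound (ρ : ℝ) (T : Finset ι) (L : ι → ℝ) (n : ℕ) : ℝ :=
  ∑ S ∈ T.powerset.filter (fun S => S.Nonempty),
    Real.exp (-(n : ℝ) * (-ρ * ∑ i ∈ S, L i / (n : ℝ) + C.exponent ρ S))

end MultiaccessChannel

section MacLength

variable {J K : ℕ}

/-- The error bound for the schedule `s` when the `s_j` messages of source `j` are encoded jointly:
source `j` is active if `s_j > 0` and then has `M_j ^ s_j` message values. -/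
noncomputable def jointEncodingBound (C : MultiaccessChannel (Fin J)) (M : Fin J → ℕ) (ρ : ℝ)
    (s : Sched J K) (n : ℕ) : ℝ :=
  C.errorBound ρ (Finset.univ.filter fun j => 0 < s.num j)
    (fun j => Real.log ((M j : ℝ) ^ s.num j)) n

/-- The error bound for the schedule `s` when each message is encoded by a terminal of its own: there
are `K` terminals `(j, 0), …, (j, K - 1)` of class `j`, the first `s_j` of them are active, and each
of these has `M_j` message values. -/
noncomputable def separateEncodingBound (C : MultiaccessChannel (Fin J × Fin K)) (M : Fin J → ℕ)
    (ρ : ℝ) (s : Sched J K) (n : ℕ) : ℝ :=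
  C.errorBound ρ (Finset.univ.filter fun i => (i.2 : ℕ) < s.num i.1)
    (fun i => Real.log (M i.1)) n

/-- `N(s)` is the smallest positive block length for which the random coding bound on the joint
decoding error probability is at most `pe`, for every non-empty schedule `s`; such block lengths are
required to exist. -/
def IsShortestLength (bound : Sched J K → ℕ → ℝ) (pe : ℝ) (N : Sched J K → ℕ) : Prop :=
  ∀ s : Sched J K, (∃ j, 0 < s.num j) → IsLeast {n : ℕ | 0 < n ∧ bound s n ≤ pe} (N s)

/-- `N` gives the codeword lengths of a `J`-source multiaccess channel with joint maximum-likelihood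
decoding, where messages of the same source in a schedule are encoded jointly. -/
def IsJointEncodingLength (N : Sched J K → ℕ) : Prop :=
  ∃ (C : MultiaccessChannel (Fin J)) (M : Fin J → ℕ) (ρ pe : ℝ), (∀ j, 2 ≤ M j) ∧
    0 ≤ ρ ∧ ρ ≤ 1 ∧ 0 < pe ∧ IsShortestLength (jointEncodingBound C M ρ) pe N

/-- `N` gives the codeword lengths of a multiaccess channel with joint maximum-likelihood decoding,
where every message is encoded independently. -/
def IsSeparateEncodingLength (N : Sched J K → ℕ) : Prop :=
  ∃ (C : MultiaccessChannel (Fin J × Fin K)) (M : Fin J → ℕ) (ρ pe : ℝ), (∀ j, 2 ≤ M j) ∧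
    0 ≤ ρ ∧ ρ ≤ 1 ∧ 0 < pe ∧ IsShortestLength (separateEncodingBound C M ρ) pe N

end MacLength

/-! ### Degraded broadcast channels with superposition encoding -/

/-- A degraded broadcast channel with `J` receivers and a superposition code ensemble. Receivers and
messages are numbered from `0`; receiver `0` has the best channel. The channel input alphabet is
`X 0`; `Q j x` is the distribution of the letter `x_j` given `x_{j+1} = x`. The alphabet `X J` is a
dummy with one letter, so that `Q (J - 1)` is an unconditional distribution. -/
structure DegradedBroadcastChannel (J : ℕ) where
  X : ℕ → Type
  Y : Fin J → Type
  finX : ∀ j, Fintype (X j)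
  finY : ∀ j, Fintype (Y j)
  dummy : Unique (X J)
  W : X 0 → PMF (∀ j, Y j)
  Q : ∀ j, X (j + 1) → PMF (X j)
  degraded : ∀ i j : Fin J, (j : ℕ) = i + 1 → ∃ D : Y i → PMF (Y j),
    ∀ x, (W x).map (fun y => y j) = ((W x).map fun y => y i).bind D

namespace DegradedBroadcastChannel

variable {J : ℕ} (C : DegradedBroadcastChannel J)

attribute [instance] DegradedBroadcastChannel.finX DegradedBroadcastChannel.finY

/-- The effective channel `p'_{Y_j | X_k}` from the letter `x_k` to the output at receiver `j`. -/
noncomputable def effective (j : Fin J) : (k : ℕ) → C.X k → PMF (C.Y j)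
  | 0, x => (C.W x).map fun y => y j
  | k + 1, x => (C.Q k x).bind (effective j k)

/-- The joint distribution `∏_j Q_j(x_j | x_{j+1})` of the letters. -/
noncomputable def joint (x : ∀ j : Fin (J + 1), C.X j) : ℝ :=
  ∏ j : Fin J, (C.Q j (x j.succ) (x j.castSucc)).toReal

/-- `E_{o, X_k, Y_j}(ρ)`: the expectation over the letters `x_{k+1}, x_{k+2}, …` is written as an
expectation over all letters, the integrand depending on `x_{k+1}` only. -/
noncomputable def exponent (ρ : ℝ) (k j : Fin J) : ℝ :=
  -Real.log (∑ x : ∀ i : Fin (J + 1), C.X i, C.joint x *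
    ∑ y : C.Y j, (∑ xk : C.X k, (C.Q k (x k.succ) xk).toReal *
      (C.effective j k xk y).toReal ^ (1 / (1 + ρ))) ^ (1 + ρ))

/-- The random coding bound `χ_j(s, n)` on the decoding error probability at receiver `j` under the
schedule `s`, with block length `n` and message alphabet sizes `M`. -/
noncomputable def errorBound {K : ℕ} (M : Fin J → ℕ) (ρ : ℝ) (j : Fin J) (s : Sched J K) (n : ℕ) :
    ℝ :=
  ∑ k ∈ Finset.univ.filter (fun k => j ≤ k),
    Real.exp (-(n : ℝ) * (C.exponent ρ k j - ρ * ((s.num k : ℝ) * Real.log (M k) / (n : ℝ))))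

end DegradedBroadcastChannel

/-- `N` gives the codeword lengths of a degraded broadcast channel with `J` receivers:
`N(s) = max {N_j(s) : s_j > 0}` for every non-empty schedule `s`, where `N_j(s)` is the smallest
positive block length for which the random coding bound at receiver `j` is at most `pe j`; such block
lengths are required to exist. -/
def IsBroadcastLength {J K : ℕ} (N : Sched J K → ℕ) : Prop :=
  ∃ (C : DegradedBroadcastChannel J) (M : Fin J → ℕ) (ρ : ℝ) (pe : Fin J → ℝ)
    (Nj : Fin J → Sched J K → ℕ), (∀ j, 2 ≤ M j) ∧ 0 ≤ ρ ∧ ρ ≤ 1 ∧ (∀ j, 0 < pe j) ∧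
    (∀ j s, 0 < s.num j → IsLeast {n : ℕ | 0 < n ∧ C.errorBound M ρ j s n ≤ pe j} (Nj j s)) ∧
    ∀ s : Sched J K, (∃ j, 0 < s.num j) →
      N s = (Finset.univ.filter fun j => 0 < s.num j).sup fun j => Nj j s

/-! Coding enters only through two properties of N: non-empty schedules have N(s) ≥ 1 (`PosLength`),
and deleting all messages of some sources does not lengthen the codeword (`MonoLength`). The rest
concerns the queueing chain.

The central quantity is H_{js} = N(s) β_{js} + s_j · (residual requirement of s), `fullWorkload`, in
which an ongoing transmission counts as if it carried s_j messages of every class j. Drawing s then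
lowers H_{js} by exactly s_j and arrivals raise it by N(s) a_{js}, unless s is drawn while idle with
fewer than s_j messages waiting. In that case H_{js} was already at most N(s) s_j, and the drop is
at most s_j (`fullWorkload_step`).

Stability: if the mean service exceeds the mean new work in every queue in use, a multiple of the
sum of the squares H_{js}² has a drift that is negative and linear in H off a finite set
(`exists_drift`). The chain need not be irreducible, so Foster's criterion (`isCRegularOn_of_drift`)
also asks that all states of this finite set lead to a common state. These paths are built by hand:
each schedule is drawn repeatedly with a fixed small arrival vector, until its queues settle at a
value independent of the starting point (`exists_common_reach`). The occupation measure of a cycle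
then gives the stationary law (`exists_invariant`).

Instability: H_{js} always dominates the step "plus new work, minus potential service", so under the
reverse strict inequality the mean of exp(-ε H_{js}) contracts geometrically for small ε
(`isTransientOn_queue`).

Regions: with the splitting of the policy, the load conditions of all s with p(s) s_j > 0 coincide
with λ_j < ∑ p(s) r_j(s). If this fails for some j, equality included, arrival laws with an atom at
0 are used: stationarity balances new work against service, but some service is wasted in a state
with an empty queue (`not_exists_invariant`). Finally, the mean rate vectors fill the convex hull,
which by `MonoLength` is downward closed in the orthant (`mem_convexHull_of_le`); hence the union of
the regions is its interior. -/

/-! ### Means under discrete laws -/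

section Mean

variable {X Y : Type*}

/-- The mean of a non-negative function under a discrete law. -/
noncomputable def mean (q : PMF X) (f : X → ℝ≥0∞) : ℝ≥0∞ := ∑' x, q x * f x

lemma mean_mono_support {q : PMF X} {f g : X → ℝ≥0∞} (h : ∀ x, q x ≠ 0 → f x ≤ g x) :
    mean q f ≤ mean q g := by
  refine ENNReal.tsum_le_tsum fun x => ?_
  by_cases hx : q x = 0
  · simp [hx]
  · gcongr
    exact h x hx

lemma mean_mono {q : PMF X} {f g : X → ℝ≥0∞} (h : ∀ x, f x ≤ g x) : mean q f ≤ mean q g :=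
  mean_mono_support fun x _ => h x

lemma mean_congr_support {q : PMF X} {f g : X → ℝ≥0∞} (h : ∀ x, q x ≠ 0 → f x = g x) :
    mean q f = mean q g :=
  le_antisymm (mean_mono_support fun x hx => (h x hx).le)
    (mean_mono_support fun x hx => (h x hx).ge)

lemma mean_add (q : PMF X) (f g : X → ℝ≥0∞) :
    mean q (fun x => f x + g x) = mean q f + mean q g := by
  simp only [mean, mul_add, ENNReal.tsum_add]

lemma mean_const (q : PMF X) (c : ℝ≥0∞) : mean q (fun _ => c) = c := by
  simp only [mean, ENNReal.tsum_mul_right, PMF.tsum_coe, one_mul]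

lemma mean_const_mul (q : PMF X) (c : ℝ≥0∞) (f : X → ℝ≥0∞) :
    mean q (fun x => c * f x) = c * mean q f := by
  simp only [mean, ← ENNReal.tsum_mul_left]
  exact tsum_congr fun x => by ring

lemma mean_mul_const (q : PMF X) (c : ℝ≥0∞) (f : X → ℝ≥0∞) :
    mean q (fun x => f x * c) = mean q f * c := by
  simp only [mean, ← ENNReal.tsum_mul_right, mul_assoc]

lemma mean_sum {ι : Type*} (q : PMF X) (s : Finset ι) (f : ι → X → ℝ≥0∞) :
    mean q (fun x => ∑ i ∈ s, f i x) = ∑ i ∈ s, mean q (f i) := by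
  classical
  induction s using Finset.induction_on with
  | empty => simp [mean]
  | insert i s hi ih => simp only [Finset.sum_insert hi, mean_add, ih]

lemma mean_tsum {ι : Type*} (q : PMF X) (f : ι → X → ℝ≥0∞) :
    mean q (fun x => ∑' i, f i x) = ∑' i, mean q (f i) := by
  simp only [mean, ← ENNReal.tsum_mul_left]
  exact ENNReal.tsum_comm

lemma mean_pure (x : X) (f : X → ℝ≥0∞) : mean (PMF.pure x) f = f x := by
  classical
  rw [mean, tsum_eq_single x]
  · simp
  · intro y hy
    simp [PMF.pure_apply, hy]

lemma mean_bind (q : PMF X) (k : X → PMF Y) (f : Y → ℝ≥0∞) :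
    mean (q.bind k) f = mean q fun x => mean (k x) f := by
  simp only [mean, PMF.bind_apply, ← ENNReal.tsum_mul_right, ← ENNReal.tsum_mul_left]
  rw [ENNReal.tsum_comm]
  simp only [mul_assoc]

lemma mean_map (q : PMF X) (g : X → Y) (f : Y → ℝ≥0∞) :
    mean (q.map g) f = mean q fun x => f (g x) := by
  rw [PMF.map, mean_bind]
  simp only [Function.comp, mean_pure]

lemma le_mean (q : PMF X) (f : X → ℝ≥0∞) (x : X) : q x * f x ≤ mean q f :=
  ENNReal.le_tsum x

lemma mean_eq_sum [Fintype X] (q : PMF X) (f : X → ℝ≥0∞) : mean q f = ∑ x, q x * f x :=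
  tsum_fintype _

end Mean

/-! ### Countable Markov chains: first passage costs and invariant laws -/

section Chain

variable {X : Type*} {P : X → PMF X} {S : Set X}

/-- No transition leaves the set `S`. -/
def IsClosedOn (P : X → PMF X) (S : Set X) : Prop := ∀ x ∈ S, ∀ x', P x x' ≠ 0 → x' ∈ S

/-- A transition from `x` to `x'` has positive probability. -/
def CanStep (P : X → PMF X) (x x' : X) : Prop := P x x' ≠ 0

lemma IsClosedOn.reach (hS : IsClosedOn P S) {x y : X} (hx : x ∈ S)
    (h : Relation.ReflTransGen (CanStep P) x y) : y ∈ S := by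
  induction h with
  | refl => exact hx
  | tail _ h ih => exact hS _ ih _ h

open Classical in
lemma tabooCost_succ (c : X → ℝ≥0∞) (y : X) (n : ℕ) (x : X) :
    tabooCost P c y (n + 1) x = mean (P x) fun x' => if x' = y then 0 else tabooCost P c y n x' :=
  rfl

open Classical in
/-- Partial sums of the taboo costs are dominated by any solution of the drift inequality. -/
lemma sum_tabooCost_le {c W : X → ℝ≥0∞} {y : X} (hS : IsClosedOn P S)
    (hW : ∀ x ∈ S, c x + mean (P x) (fun x' => if x' = y then 0 else W x') ≤ W x) (m : ℕ) :
    ∀ x ∈ S, ∑ n ∈ Finset.range m, tabooCost P c y n x ≤ W x := by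
  induction m with
  | zero => simp
  | succ m ih =>
    intro x hx
    refine le_trans ?_ (hW x hx)
    rw [Finset.sum_range_succ', add_comm]
    refine add_le_add le_rfl ?_
    simp only [tabooCost_succ]
    rw [← mean_sum]
    refine mean_mono_support fun x' hx' => ?_
    split_ifs
    · simp
    · exact ih x' (hS x hx x' hx')

lemma expectedCost_le {c W : X → ℝ≥0∞} {y : X} (hS : IsClosedOn P S)
    (hW : ∀ x ∈ S, c x + mean (P x) (open Classical in fun x' => if x' = y then 0 else W x') ≤ W x)
    {x : X} (hx : x ∈ S) : expectedCost P c x y ≤ W x := by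
  rw [expectedCost, ENNReal.tsum_eq_iSup_nat]
  exact iSup_le fun m => sum_tabooCost_le hS hW m x hx

lemma tabooCost_mono {c d : X → ℝ≥0∞} (h : ∀ x, c x ≤ d x) (y : X) (n : ℕ) :
    ∀ x, tabooCost P c y n x ≤ tabooCost P d y n x := by
  induction n with
  | zero => exact h
  | succ n ih =>
    intro x
    simp only [tabooCost_succ]
    refine mean_mono fun x' => ?_
    split_ifs
    · exact le_rfl
    · exact ih x'

lemma tabooCost_one_le (y : X) (n : ℕ) : ∀ x, tabooCost P (fun _ => 1) y n x ≤ 1 := by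
  induction n with
  | zero => intro x; exact le_rfl
  | succ n ih =>
    intro x
    rw [tabooCost_succ]
    refine (mean_mono (g := fun _ => 1) fun x' => ?_).trans (mean_const _ _).le
    split_ifs
    · simp
    · exact ih x'

lemma mean_lt_one {q : PMF X} {f : X → ℝ≥0∞} (hf : ∀ x, f x ≤ 1) {x : X} (hx : q x ≠ 0)
    (hfx : f x < 1) : mean q f < 1 := by
  have h : mean q f < ∑' x, q x := by
    refine ENNReal.tsum_lt_tsum (i := x) ?_ (fun y => ?_) ?_
    · exact ((mean_mono hf).trans (mean_const _ _).le).trans_lt ENNReal.one_lt_top |>.ne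
    · exact mul_le_of_le_one_right' (hf y)
    · exact (ENNReal.mul_lt_mul_right hx (q.apply_ne_top x) hfx).trans_eq (mul_one _)
  simpa using h

/-- With cost 1 the taboo cost is the tail P_x(τ_y > n). A path of positive probability from x to y
makes this tail smaller than 1 from the length of the path on. -/
lemma tabooCost_one_lt {x y : X} (h : Relation.TransGen (CanStep P) x y) :
    ∃ m, ∀ n, m ≤ n → tabooCost P (fun _ => 1) y n x < 1 := by
  classical
  induction h using Relation.TransGen.head_induction_on with
  | single hx =>
    refine ⟨1, fun n hn => ?_⟩
    obtain ⟨n, rfl⟩ := Nat.exists_eq_add_of_le' hn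
    rw [tabooCost_succ]
    refine mean_lt_one (fun x' => ?_) hx (by simp)
    split_ifs
    · simp
    · exact tabooCost_one_le y n x'
  | head hx _ ih =>
    obtain ⟨m, hm⟩ := ih
    refine ⟨m + 1, fun n hn => ?_⟩
    obtain ⟨n, rfl⟩ := Nat.exists_eq_add_of_le' (le_of_add_le_right hn)
    rw [tabooCost_succ]
    refine mean_lt_one (fun x' => ?_) hx ?_
    · split_ifs
      · simp
      · exact tabooCost_one_le y n x'
    · split_ifs
      · simp
      · exact hm n (by omega)

/-- Foster's criterion with costs: a drift condition off a finite set all of whose states lead to `y`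
makes the mean cost until the first passage to `y` finite. -/
theorem isCRegularOn_of_drift {c V : X → ℝ≥0∞} {C : Set X} {b : ℝ≥0∞} {y : X}
    (hS : IsClosedOn P S) (hC : C.Finite) (hb : b ≠ ∞) (hV : ∀ x ∈ S, V x ≠ ∞)
    (hdrift : ∀ x ∈ S, mean (P x) V + c x ≤ V x + (open Classical in if x ∈ C then b else 0))
    (hy : y ∈ S) (hreach : ∀ x ∈ C, Relation.TransGen (CanStep P) x y) :
    IsCRegularOn P S c := by
  classical
  refine ⟨y, hy, ?_⟩
  choose! m hm using fun x hx => tabooCost_one_lt (hreach x hx)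
  obtain ⟨M, hM⟩ : ∃ M, ∀ x ∈ C, tabooCost P (fun _ => 1) y M x < 1 := by
    refine ⟨hC.toFinset.sup m, fun x hx => hm x hx _ ?_⟩
    exact Finset.le_sup (f := m) (hC.mem_toFinset.2 hx)
  -- C is finite, so the probability of hitting y within M steps is at least some δ > 0 uniformly on
  -- C.
  obtain ⟨δ, hδ0, hδ1, hδ⟩ : ∃ δ : ℝ≥0∞, δ ≠ 0 ∧ δ ≤ 1 ∧
      ∀ x ∈ C, tabooCost P (fun _ => 1) y M x ≤ 1 - δ := by
    set t := hC.toFinset.sup (fun x => tabooCost P (fun _ => 1) y M x) with ht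
    have ht1 : t < 1 := by
      rw [ht, Finset.sup_lt_iff (by simp)]
      intro x hx
      exact hM x (hC.mem_toFinset.1 hx)
    refine ⟨1 - t, (tsub_pos_of_lt ht1).ne', tsub_le_self, fun x hx => ?_⟩
    rw [ENNReal.sub_sub_cancel ENNReal.one_ne_top ht1.le]
    exact Finset.le_sup (f := fun x => tabooCost P (fun _ => 1) y M x) (hC.mem_toFinset.2 hx)
  have hδt : δ ≠ ∞ := ne_top_of_le_ne_top ENNReal.one_ne_top hδ1
  -- f(x) = E_x[min(τ_y, M)], a function bounded by M. Killed at y, its one-step mean is f(x) - 1 +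
  -- P_x(τ_y > M): never above f(x), and at least δ below it on C.
  set f : X → ℝ≥0∞ := fun x => ∑ n ∈ Finset.range M, tabooCost P (fun _ => 1) y n x with hf
  have hff : ∀ x, f x ≤ M := fun x => by
    refine (Finset.sum_le_sum fun n _ => tabooCost_one_le y n x).trans ?_
    simp
  have hQf : ∀ x, mean (P x) (fun x' => if x' = y then 0 else f x') + 1
      = f x + tabooCost P (fun _ => 1) y M x := by
    intro x
    have h1 : mean (P x) (fun x' => if x' = y then 0 else f x')
        = ∑ n ∈ Finset.range M, tabooCost P (fun _ => 1) y (n + 1) x := by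
      simp only [tabooCost_succ]
      rw [← mean_sum]
      congr 1
      funext x'
      split_ifs
      · simp
      · rfl
    rw [h1]
    show _ + tabooCost P (fun _ => 1) y 0 x = _
    rw [← Finset.sum_range_succ' fun n => tabooCost P (fun _ => 1) y n x, Finset.sum_range_succ]
  have hQδ : ∀ x, mean (P x) (fun x' => if x' = y then 0 else f x') +
      (if x ∈ C then δ else 0) ≤ f x := by
    intro x
    have hfin : (1 - δ) ≠ ∞ := ne_top_of_le_ne_top ENNReal.one_ne_top tsub_le_self
    by_cases hx : x ∈ C
    · rw [if_pos hx]
      refine (ENNReal.add_le_add_iff_right hfin).1 ?_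
      rw [add_assoc, add_tsub_cancel_of_le hδ1, hQf x]
      exact add_le_add le_rfl (hδ x hx)
    · rw [if_neg hx, add_zero]
      refine (ENNReal.add_le_add_iff_right ENNReal.one_ne_top).1 ?_
      rw [hQf x]
      exact add_le_add le_rfl (tabooCost_one_le y M x)
  -- The decrease δ of f on C, scaled by b / δ, cancels the excess b of the drift of V there. So W
  -- solves the drift inequality with killing at y everywhere on S.
  set W : X → ℝ≥0∞ := fun x => V x + b / δ * f x with hWdef
  have hW : ∀ x ∈ S, c x + mean (P x) (fun x' => if x' = y then 0 else W x') ≤ W x := by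
    intro x hx
    have h1 : mean (P x) (fun x' => if x' = y then 0 else W x') ≤
        mean (P x) V + b / δ * mean (P x) (fun x' => if x' = y then 0 else f x') := by
      rw [← mean_const_mul, ← mean_add]
      refine mean_mono fun x' => ?_
      split_ifs
      · simp
      · exact le_rfl
    have h2 : (if x ∈ C then b else 0) = b / δ * (if x ∈ C then δ else 0) := by
      split_ifs
      · rw [ENNReal.div_mul_cancel hδ0 hδt]
      · simp
    calc _ ≤ c x + (mean (P x) V + b / δ * mean (P x) (fun x' => if x' = y then 0 else f x')) := by
          gcongr
      _ = (mean (P x) V + c x) + b / δ * mean (P x) (fun x' => if x' = y then 0 else f x') := by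
          ring
      _ ≤ (V x + (if x ∈ C then b else 0)) +
          b / δ * mean (P x) (fun x' => if x' = y then 0 else f x') := by
          exact add_le_add (hdrift x hx) le_rfl
      _ = V x + b / δ * (mean (P x) (fun x' => if x' = y then 0 else f x') +
            (if x ∈ C then δ else 0)) := by rw [h2]; ring
      _ ≤ W x := by
          exact add_le_add le_rfl (mul_le_mul_right (hQδ x) _)
  intro x hx
  refine (expectedCost_le hS hW hx).trans_lt ?_
  refine ENNReal.add_lt_top.2 ⟨(hV x hx).lt_top, ENNReal.mul_lt_top ?_ ?_⟩
  · exact ENNReal.div_lt_top hb hδ0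
  · exact (hff x).trans_lt (ENNReal.natCast_lt_top M)

/-! ### The cycle formula for invariant laws; costs are now unfolded at the last step instead of the
first. -/

open Classical in
lemma tabooCost_succ' (c : X → ℝ≥0∞) (y : X) (n : ℕ) :
    ∀ x, tabooCost P c y (n + 1) x =
      tabooCost P (fun z => mean (P z) fun x' => if x' = y then 0 else c x') y n x := by
  induction n with
  | zero => intro x; rfl
  | succ n ih =>
    intro x
    rw [tabooCost_succ]
    conv_rhs => rw [tabooCost_succ]
    congr 1
    funext x'
    rw [ih]

lemma tabooCost_add (c d : X → ℝ≥0∞) (y : X) (n : ℕ) :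
    ∀ x, tabooCost P (fun z => c z + d z) y n x = tabooCost P c y n x + tabooCost P d y n x := by
  classical
  induction n with
  | zero => intro x; rfl
  | succ n ih =>
    intro x
    simp only [tabooCost_succ]
    rw [← mean_add]
    congr 1
    funext x'
    rw [ih]
    split_ifs <;> simp

lemma tabooCost_mul (c : X → ℝ≥0∞) (a : ℝ≥0∞) (y : X) (n : ℕ) :
    ∀ x, tabooCost P (fun z => a * c z) y n x = a * tabooCost P c y n x := by
  classical
  induction n with
  | zero => intro x; rfl
  | succ n ih =>
    intro x
    simp only [tabooCost_succ]
    rw [← mean_const_mul]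
    congr 1
    funext x'
    rw [ih]
    split_ifs <;> simp

lemma tabooCost_tsum {ι : Type*} (c : ι → X → ℝ≥0∞) (y : X) (n : ℕ) :
    ∀ x, tabooCost P (fun z => ∑' i, c i z) y n x = ∑' i, tabooCost P (c i) y n x := by
  classical
  induction n with
  | zero => intro x; rfl
  | succ n ih =>
    intro x
    simp only [tabooCost_succ]
    rw [← mean_tsum]
    congr 1
    funext x'
    rw [ih]
    split_ifs <;> simp

lemma tabooCost_eq_zero (hS : IsClosedOn P S) {c : X → ℝ≥0∞} (hc : ∀ x ∈ S, c x = 0) (y : X)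
    (n : ℕ) : ∀ x ∈ S, tabooCost P c y n x = 0 := by
  classical
  induction n with
  | zero => exact hc
  | succ n ih =>
    intro x hx
    rw [tabooCost_succ, mean_congr_support (g := fun _ => 0), mean_const]
    intro x' hx'
    rw [ih x' (hS x hx x' hx'), ite_self]

/-- One-step shift of the accumulated costs along a cycle from `y` to `y`. -/
lemma expectedCost_shift (c : X → ℝ≥0∞) (y : X) :
    expectedCost P (fun z => mean (P z) c) y y + c y =
      expectedCost P c y y + c y * expectedCost P (fun z => P z y) y y := by
  classical
  have h1 : ∀ z, mean (P z) c = mean (P z) (fun x' => if x' = y then 0 else c x') + c y * P z y := by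
    intro z
    have : mean (P z) (fun x' => if x' = y then c x' else 0) = c y * P z y := by
      rw [mean, tsum_eq_single y]
      · simp [mul_comm]
      · intro x' hx'; simp [hx']
    rw [← this, ← mean_add]
    congr 1
    funext x'
    split_ifs <;> simp
  have h2 : expectedCost P c y y
      = c y + expectedCost P (fun z => mean (P z) (fun x' => if x' = y then 0 else c x')) y y := by
    unfold expectedCost
    rw [tsum_eq_zero_add' ENNReal.summable]
    simp only [tabooCost_succ']
    rfl
  rw [h2]
  simp only [h1]
  unfold expectedCost
  simp only [tabooCost_add, tabooCost_mul, ENNReal.tsum_add, ENNReal.tsum_mul_left]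
  ring

/-- A chain which returns to `y` in finite mean time has an invariant law, and the mean of a cost
which is summable along the cycle is finite. -/
theorem exists_invariant {y : X} (hS : IsClosedOn P S) (hy : y ∈ S)
    (hτ : expectedCost P (fun _ => 1) y y ≠ ∞) {d : X → ℝ≥0∞} (hd : expectedCost P d y y ≠ ∞) :
    ∃ π : PMF X, π.support ⊆ S ∧ π.bind P = π ∧ ∑' x, π x * d x < ∞ := by
  classical
  set τ := expectedCost P (fun _ => 1) y y with hτdef
  have hτ0 : τ ≠ 0 := by
    have : (1 : ℝ≥0∞) ≤ τ := ENNReal.le_tsum (f := fun n => tabooCost P (fun _ => 1) y n y) 0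
    exact fun h => by simp [h] at this
  -- The mean number of visits to x during a cycle from y. Every cycle cost is the integral of the
  -- cost against G, and G has total mass τ.
  set G : X → ℝ≥0∞ := fun x => expectedCost P (fun z => if z = x then 1 else 0) y y with hG
  have hrep : ∀ c : X → ℝ≥0∞, expectedCost P c y y = ∑' x, G x * c x := by
    intro c
    have : c = fun z => ∑' x, c x * (if z = x then 1 else 0) := by
      funext z
      rw [tsum_eq_single z]
      · simp
      · intro x hx; simp [hx.symm]
    conv_lhs => rw [this]
    simp only [hG, expectedCost, tabooCost_tsum, tabooCost_mul]
    rw [ENNReal.tsum_comm]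
    refine tsum_congr fun x => ?_
    rw [ENNReal.tsum_mul_left, mul_comm]
  -- The left side is the probability of returning to y. The shift identity for the cost 1 reads τ +
  -- 1 = τ + (return probability), and τ is finite.
  have hret : expectedCost P (fun z => P z y) y y = 1 := by
    have h := expectedCost_shift (P := P) (fun _ => 1) y
    simp only [mean_const, one_mul] at h
    exact ((ENNReal.add_right_inj hτ).1 h).symm
  have hGinv : ∀ x, ∑' z, G z * P z x = G x := by
    intro x
    have h := expectedCost_shift (P := P) (fun z => if z = x then 1 else 0) y
    rw [hret, mul_one] at h
    have h' := (ENNReal.add_left_inj (by split_ifs <;> simp)).1 h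
    rw [hrep] at h'
    rw [← hG] at *
    convert h' using 1
    refine tsum_congr fun z => ?_
    congr 1
    rw [mean, tsum_eq_single x]
    · simp
    · intro w hw; simp [hw]
  have hsum : ∑' x, G x = τ := by
    rw [hτdef, hrep]; simp
  obtain ⟨π, hπ⟩ : ∃ π : PMF X, ∀ x, π x = τ⁻¹ * G x := by
    have : ∑' x, τ⁻¹ * G x = 1 := by
      rw [ENNReal.tsum_mul_left, hsum, ENNReal.inv_mul_cancel hτ0 hτ]
    exact ⟨⟨fun x => τ⁻¹ * G x, this ▸ ENNReal.summable.hasSum⟩, fun _ => rfl⟩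
  refine ⟨π, ?_, ?_, ?_⟩
  · intro x hx
    by_contra hxS
    apply hx
    have : G x = 0 := by
      rw [hG]
      simp only [expectedCost]
      rw [ENNReal.tsum_eq_zero]
      intro n
      refine tabooCost_eq_zero hS (fun z hz => ?_) y n y hy
      rw [if_neg]
      rintro rfl
      exact hxS hz
    rw [hπ, this, mul_zero]
  · ext x
    simp only [PMF.bind_apply, hπ, mul_assoc]
    rw [ENNReal.tsum_mul_left, hGinv]
  · simp only [hπ, mul_assoc]
    rw [ENNReal.tsum_mul_left, ← hrep]
    exact ENNReal.mul_lt_top (ENNReal.inv_lt_top.2 (pos_iff_ne_zero.2 hτ0)) hd.lt_top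

lemma expectedCost_mono {c d : X → ℝ≥0∞} (h : ∀ x, c x ≤ d x) (x y : X) :
    expectedCost P c x y ≤ expectedCost P d x y :=
  ENNReal.tsum_le_tsum fun n => tabooCost_mono h y n x

/-- `c`-regularity with a cost that dominates `1` and the number of customers implies stability. -/
theorem IsCRegularOn.isStableOn {c : X → ℝ≥0∞} (hS : IsClosedOn P S) (h : IsCRegularOn P S c)
    (h1 : ∀ x, 1 ≤ c x) {num : X → ℕ}
    (hnum : ∀ x ∈ S, (num x : ℝ≥0∞) ≤ c x) :
    IsStableOn P S num := by
  obtain ⟨y, hy, hfin⟩ := h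
  have h1' : ∀ x ∈ S, expectedCost P (fun _ => 1) x y < ∞ := fun x hx =>
    (expectedCost_mono h1 x y).trans_lt (hfin x hx)
  obtain ⟨π, hπS, hπ, hm⟩ := exists_invariant hS hy (h1' y hy).ne (hfin y hy).ne
  refine ⟨⟨y, hy, h1'⟩, π, hπS, hπ, ?_⟩
  exact (mean_mono_support fun x hx => hnum x (hπS hx)).trans_lt hm

/-- A geometric supermartingale gives transience. -/
theorem isTransientOn_of_geometric {g : X → ℝ≥0∞} {φ : ℝ≥0∞} (hS : IsClosedOn P S) (hφ : φ < 1)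
    (hg0 : ∀ x, g x ≠ 0) (hgt : ∀ x, g x ≠ ∞) (h : ∀ x ∈ S, mean (P x) g ≤ φ * g x) :
    IsTransientOn P S := by
  intro x hx
  have hsupp : ∀ n z, stepLaw P x n z ≠ 0 → z ∈ S := by
    intro n
    induction n with
    | zero =>
      intro z hz
      have : z = x := by simpa [stepLaw, PMF.pure_apply] using hz
      exact this ▸ hx
    | succ n ih =>
      intro z hz
      rw [stepLaw, ← PMF.mem_support_iff, PMF.mem_support_bind_iff] at hz
      obtain ⟨w, hw, hz⟩ := hz
      exact hS w (ih w hw) z hz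
  have hmean : ∀ n, mean (stepLaw P x n) g ≤ φ ^ n * g x := by
    intro n
    induction n with
    | zero => simp [stepLaw, mean_pure]
    | succ n ih =>
      rw [stepLaw, mean_bind]
      calc _ ≤ mean (stepLaw P x n) fun z => φ * g z :=
            mean_mono_support fun z hz => h z (hsupp n z hz)
        _ = φ * mean (stepLaw P x n) g := mean_const_mul _ _ _
        _ ≤ φ * (φ ^ n * g x) := by gcongr
        _ = _ := by ring
  have hle : ∀ n, stepLaw P x n x ≤ φ ^ n := fun n =>
    (ENNReal.mul_le_mul_iff_left (hg0 x) (hgt x)).1 ((le_mean _ g x).trans (hmean n))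
  refine (ENNReal.tsum_le_tsum hle).trans_lt ?_
  rw [ENNReal.tsum_geometric]
  exact ENNReal.inv_lt_top.2 (tsub_pos_of_lt hφ)

end Chain

/-! ### Moments and support of the arrival law -/

lemma exists_lt_of_mean_lt {X : Type*} {q : PMF X} {f : X → ℝ≥0∞} {c : ℝ≥0∞} (h : mean q f < c) :
    ∃ x, q x ≠ 0 ∧ f x < c := by
  by_contra! hc
  exact h.not_ge ((mean_const q c).ge.trans (mean_mono_support hc))

lemma mean_eq_zero {X : Type*} {q : PMF X} {f : X → ℝ≥0∞} (h : mean q f = 0) {x : X}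
    (hx : q x ≠ 0) : f x = 0 := by
  have := (ENNReal.tsum_eq_zero.1 h) x
  exact (mul_eq_zero.1 this).resolve_left hx

section LabelCounts

variable {S : Type*} [DecidableEq S]

lemma labelCounts_le (μ : PMF S) (s : S) (n : ℕ) :
    ∀ c, labelCounts μ n c ≠ 0 → c s ≤ n := by
  induction n with
  | zero =>
    intro c hc
    rw [labelCounts, ← PMF.mem_support_iff, PMF.mem_support_pure_iff] at hc
    simp [hc]
  | succ n ih =>
    intro c hc
    rw [labelCounts, ← PMF.mem_support_iff, PMF.mem_support_bind_iff] at hc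
    obtain ⟨c', hc', hc⟩ := hc
    rw [PMF.mem_support_map_iff] at hc
    obtain ⟨t, -, rfl⟩ := hc
    have := ih c' hc'
    rcases eq_or_ne s t with rfl | h
    · simpa using this
    · rw [Function.update_of_ne h]; omega

lemma mean_labelCounts (μ : PMF S) (s : S) (n : ℕ) :
    mean (labelCounts μ n) (fun c => (c s : ℝ≥0∞)) = n * μ s := by
  induction n with
  | zero => simp [labelCounts, mean_pure]
  | succ n ih =>
    have hs : mean μ (fun t => if t = s then (1 : ℝ≥0∞) else 0) = μ s := by
      rw [mean, tsum_eq_single s]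
      · simp
      · intro t ht; simp [ht]
    have h : ∀ c : S → ℕ, mean μ (fun t => ((Function.update c t (c t + 1) s : ℕ) : ℝ≥0∞))
        = c s + μ s := by
      intro c
      rw [← hs, ← mean_const μ (c s : ℝ≥0∞), ← mean_add]
      congr 1
      funext t
      rcases eq_or_ne t s with rfl | ht
      · simp
      · simp [Function.update_of_ne ht.symm, ht]
    rw [labelCounts, mean_bind]
    simp only [mean_map, h]
    rw [mean_add, ih, mean_const]
    push_cast
    ring

end LabelCounts

lemma mean_indepLaw {β : Type*} {J : ℕ} (q : Fin J → PMF β) (j : Fin J) (g : β → ℝ≥0∞) :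
    mean (indepLaw q) (fun f => g (f j)) = mean (q j) g := by
  induction J with
  | zero => exact j.elim0
  | succ J ih =>
    rw [indepLaw, mean_bind]
    simp only [mean_map]
    refine Fin.cases ?_ (fun i => ?_) j
    · simp only [Fin.cons_zero, mean_const]
    · simp only [Fin.cons_succ]
      rw [mean_const, ih]

lemma indepLaw_ne_zero {β : Type*} {J : ℕ} (q : Fin J → PMF β) (f : Fin J → β)
    (h : ∀ j, q j (f j) ≠ 0) : indepLaw q f ≠ 0 := by
  induction J with
  | zero =>
    rw [indepLaw, ← PMF.mem_support_iff, PMF.mem_support_pure_iff]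
    exact Subsingleton.elim _ _
  | succ J ih =>
    rw [indepLaw, ← PMF.mem_support_iff, PMF.mem_support_bind_iff]
    refine ⟨f 0, h 0, ?_⟩
    rw [PMF.mem_support_map_iff]
    exact ⟨fun i => f i.succ, ih _ _ fun i => h i.succ, Fin.cons_self_tail f⟩

section Arrivals

variable {J K : ℕ} {A : Fin J → PMF ℕ} {μ : Fin J → PMF (Sched J K)} {lam : Fin J → ℝ≥0}

lemma mean_arrivalLaw_class (A : Fin J → PMF ℕ) (μ : Fin J → PMF (Sched J K)) (j : Fin J)
    (g : (Sched J K → ℕ) → ℝ≥0∞) :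
    mean (arrivalLaw A μ) (fun a => g (a j)) =
      mean (A j) fun n => mean (labelCounts (μ j) n) g := by
  rw [arrivalLaw, mean_indepLaw, mean_bind]

lemma mean_arrivals_class (hA : HasRates A lam) (μ : Fin J → PMF (Sched J K)) (j : Fin J)
    (s : Sched J K) :
    mean ((A j).bind fun n => labelCounts (μ j) n) (fun c => (c s : ℝ≥0∞)) = lam j * μ j s := by
  rw [mean_bind]
  simp only [mean_labelCounts]
  rw [mean_mul_const, ← (hA j).1, mean]

lemma mean_arrivals (hA : HasRates A lam) (μ : Fin J → PMF (Sched J K)) (j : Fin J)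
    (s : Sched J K) :
    mean (arrivalLaw A μ) (fun a => (a j s : ℝ≥0∞)) = lam j * μ j s := by
  rw [← mean_arrivals_class hA μ j s, mean_bind]
  exact mean_arrivalLaw_class A μ j fun c => (c s : ℝ≥0∞)

lemma mean_arrivals_sq_lt_top (hA : HasRates A lam) (μ : Fin J → PMF (Sched J K)) (j : Fin J)
    (s : Sched J K) :
    mean (arrivalLaw A μ) (fun a => (a j s : ℝ≥0∞) ^ 2) < ∞ := by
  rw [mean_arrivalLaw_class A μ j fun c => (c s : ℝ≥0∞) ^ 2]
  refine (mean_mono (g := fun n : ℕ => (n : ℝ≥0∞) ^ 2) fun n => ?_).trans_lt (hA j).2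
  refine (mean_mono_support (g := fun _ => (n : ℝ≥0∞) ^ 2) fun c hc => ?_).trans (mean_const _ _).le
  gcongr
  exact labelCounts_le (μ j) s n c hc

/-- A count with mean λ_j · 0 = 0 vanishes almost surely. This keeps queues that are not in use
empty. -/
lemma splitting_ne_zero_of_arrival (hA : HasRates A lam) {a : Fin J → Sched J K → ℕ}
    (ha : arrivalLaw A μ a ≠ 0) {j : Fin J} {s : Sched J K} (h : a j s ≠ 0) : μ j s ≠ 0 := by
  intro h0
  have hm := mean_arrivals hA μ j s
  rw [h0, mul_zero] at hm
  exact h (by exact_mod_cast mean_eq_zero hm ha)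

/-- Arrival vectors whose components are not above the mean rates occur with positive probability. -/
lemma exists_small_arrivals (hA : HasRates A lam) (s : Sched J K) (N : ℕ) (B : Fin J → ℕ)
    (hB : ∀ j, μ j s ≠ 0 → (N : ℝ) * ((lam j : ℝ) * (μ j s).toReal) < B j) :
    ∃ a, arrivalLaw A μ a ≠ 0 ∧ ∀ j, μ j s ≠ 0 → N * a j s < B j := by
  -- Only the coordinate s matters, one per class, and classes are independent. So each class may
  -- choose its own vector of counts, with a value of its count for s not above the mean.
  have key : ∀ j, ∃ c : Sched J K → ℕ, ((A j).bind fun n => labelCounts (μ j) n) c ≠ 0 ∧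
      (μ j s ≠ 0 → N * c s < B j) := by
    intro j
    by_cases hj : μ j s = 0
    · obtain ⟨c, hc⟩ := ((A j).bind fun n => labelCounts (μ j) n).support_nonempty
      exact ⟨c, hc, fun h => absurd hj h⟩
    · have hm : mean ((A j).bind fun n => labelCounts (μ j) n)
          (fun c => (N : ℝ≥0∞) * (c s : ℝ≥0∞)) < B j := by
        rw [mean_const_mul, mean_arrivals_class hA]
        have hfin : (N : ℝ≥0∞) * (lam j * μ j s) ≠ ∞ :=
          ENNReal.mul_ne_top (by simp) (ENNReal.mul_ne_top (by simp) ((μ j).apply_ne_top s))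
        rw [← ENNReal.toReal_lt_toReal hfin (by simp)]
        simpa using hB j hj
      obtain ⟨c, hc, hlt⟩ := exists_lt_of_mean_lt hm
      exact ⟨c, hc, fun _ => by exact_mod_cast hlt⟩
  choose a ha using key
  exact ⟨a, indepLaw_ne_zero _ _ fun j => (ha j).1, fun j => (ha j).2⟩

end Arrivals

/-! ### Structure and dynamics of the states -/

section Dynamics

variable {J K : ℕ} {N : Sched J K → ℕ} {p : PMF (Sched J K)} {μ : Fin J → PMF (Sched J K)}

/-- The state with `u j s` messages with residual requirement `r s` and `b j s` fresh messages in the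
queue `(j, s)`. -/
def encode (N : Sched J K → ℕ) (r : Sched J K → ℕ) (u b : Fin J → Sched J K → ℕ) : QState J K :=
  fun j s => List.replicate (u j s) (r s) ++ List.replicate (b j s) (N s)

/-- Admissible configurations: `r s = 0` means that there is no ongoing transmission of `s`. -/
structure IsConfig (N : Sched J K → ℕ) (p : PMF (Sched J K)) (μ : Fin J → PMF (Sched J K))
    (r : Sched J K → ℕ) (u b : Fin J → Sched J K → ℕ) : Prop where
  inUse : ∀ j s, u j s ≠ 0 ∨ b j s ≠ 0 → InUse p μ j s
  le_num : ∀ j s, u j s ≤ s.num j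
  idle : ∀ s, r s = 0 → ∀ j, u j s = 0
  busy : ∀ s, r s ≠ 0 → r s < N s ∧ ∃ j, u j s ≠ 0

/-- The residual requirement of the ongoing transmission of `s`, and `0` if there is none. -/
def residualOf (N : Sched J K → ℕ) (α : QState J K) (s : Sched J K) : ℕ :=
  Finset.univ.sup fun j => (α j s).headD 0 % N s

/-- The workload of the queue `(j, s)` when the ongoing transmission of `s` is counted as if it had
full size. -/
def fullWorkload (N : Sched J K → ℕ) (α : QState J K) (j : Fin J) (s : Sched J K) : ℕ :=
  N s * fresh N α j s + s.num j * residualOf N α s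

/-- Every non-empty schedule has a positive codeword length. -/
def PosLength (N : Sched J K → ℕ) : Prop := ∀ s : Sched J K, ∀ j, 0 < s.num j → 1 ≤ N s

variable {r : Sched J K → ℕ} {u b : Fin J → Sched J K → ℕ}

lemma IsConfig.lt_of_ne (h : IsConfig N p μ r u b) {j : Fin J} {s : Sched J K} (hu : u j s ≠ 0) :
    0 < r s ∧ r s < N s := by
  have hr : r s ≠ 0 := fun h0 => hu (h.idle s h0 j)
  exact ⟨Nat.pos_of_ne_zero hr, (h.busy s hr).1⟩

lemma encode_mem (hN : PosLength N) (h : IsConfig N p μ r u b) :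
    encode N r u b ∈ stateSpace N p μ := by
  refine ⟨fun j s hne => h.inUse j s ?_, fun j s x hx => ?_, fun s => ⟨r s, fun j =>
    ⟨u j s, h.le_num j s, b j s, fun hu => (h.lt_of_ne hu).2, rfl⟩⟩⟩
  · by_contra! h0
    exact hne (by simp [encode, h0.1, h0.2])
  · rw [encode, List.mem_append, List.mem_replicate, List.mem_replicate] at hx
    rcases hx with ⟨hu, rfl⟩ | ⟨hb, rfl⟩
    · exact (h.lt_of_ne hu).1
    · exact hN s j (h.inUse j s (Or.inr hb)).1

/-- The state space leaves the residual r of s undetermined when no message of s is in transmission;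
setting r = 0 in that case normalizes it. -/
lemma exists_config {α : QState J K} (hα : α ∈ stateSpace N p μ) :
    ∃ r u b, IsConfig N p μ r u b ∧ α = encode N r u b := by
  classical
  obtain ⟨h1, h2, h3⟩ := hα
  choose r0 h3 using h3
  choose u0 hu0 b0 hr0 h3 using h3
  have hα : ∀ j s, u0 s j ≠ 0 → r0 s ≠ 0 := fun j s hu =>
    (h2 j s (r0 s) (by rw [h3 s j]; simp [hu])).ne'
  refine ⟨fun s => if ∃ j, u0 s j ≠ 0 then r0 s else 0, fun j s => u0 s j, fun j s => b0 s j,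
    ⟨fun j s h => h1 j s ?_, fun j s => hu0 s j, fun s hs j => ?_, fun s hs => ?_⟩, ?_⟩
  · rw [h3 s j]
    rcases h with h | h <;> simp [h]
  · by_contra hj
    rw [if_pos ⟨j, hj⟩] at hs
    exact hα j s hj hs
  · have hex : ∃ j, u0 s j ≠ 0 := by
      by_contra hex
      exact hs (if_neg hex)
    simp only [if_pos hex]
    obtain ⟨j, hj⟩ := hex
    exact ⟨hr0 s j hj, j, hj⟩
  · funext j s
    rw [h3 s j, encode]
    by_cases hu : u0 s j = 0
    · simp [hu]
    · rw [if_pos ⟨j, hu⟩]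

namespace IsConfig

variable (h : IsConfig N p μ r u b)
include h

lemma fresh_encode (j : Fin J) (s : Sched J K) : fresh N (encode N r u b) j s = b j s := by
  rw [fresh, encode, List.countP_append, List.countP_replicate, List.countP_replicate]
  by_cases hu : u j s = 0
  · simp [hu]
  · simp [(h.lt_of_ne hu).2.ne]

lemma ongoing_encode (s : Sched J K) (j : Fin J) (t : Sched J K) :
    ongoing N (encode N r u b) s j t = if t = s then u j s else 0 := by
  rw [ongoing]
  refine if_congr Iff.rfl ?_ rfl
  rw [encode, List.countP_append, List.countP_replicate, List.countP_replicate]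
  by_cases hu : u j s = 0
  · simp [hu]
  · simp [(h.lt_of_ne hu).2]

/-- Modulo `N s` a fresh head becomes 0 and a residual `r s < N s` is unchanged. The supremum over
the classes picks the common residual from any queue that takes part. -/
lemma residual_encode (s : Sched J K) : residualOf N (encode N r u b) s = r s := by
  have hle : ∀ j, (encode N r u b j s).headD 0 % N s ≤ r s := by
    intro j
    rw [encode]
    cases hu : u j s with
    | zero =>
      cases hb : b j s with
      | zero => simp
      | succ k => simp [List.replicate_succ]
    | succ k => simpa [List.replicate_succ] using Nat.mod_le _ _
  refine le_antisymm (Finset.sup_le fun j _ => hle j) ?_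
  by_cases hr : r s = 0
  · simp [hr]
  obtain ⟨hlt, j, hj⟩ := h.busy s hr
  refine le_trans ?_ (Finset.le_sup (f := fun j => (encode N r u b j s).headD 0 % N s)
    (Finset.mem_univ j))
  obtain ⟨k, hk⟩ := Nat.exists_eq_succ_of_ne_zero hj
  simp [encode, hk, List.replicate_succ, Nat.mod_eq_of_lt hlt]

lemma implemented_encode (s : Sched J K) :
    implemented N (encode N r u b) s = fun j t =>
      if t = s then (if r s = 0 then min (s.num j) (b j s) else u j s) else 0 := by
  rw [implemented]
  have hiff : (∃ j t, ongoing N (encode N r u b) s j t ≠ 0) ↔ r s ≠ 0 := by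
    simp only [h.ongoing_encode]
    constructor
    · rintro ⟨j, t, hjt⟩ h0
      refine hjt ?_
      rw [h.idle s h0 j, ite_self]
    · intro hr
      obtain ⟨-, j, hj⟩ := h.busy s hr
      exact ⟨j, s, by simpa using hj⟩
  by_cases hr : r s = 0
  · rw [if_neg (by rw [hiff]; simpa using hr)]
    funext j t
    rw [maximal, if_pos hr]
    refine if_congr Iff.rfl ?_ rfl
    simp [encode, h.idle s hr j]
  · rw [if_pos (hiff.2 hr)]
    funext j t
    rw [h.ongoing_encode, if_neg hr]

end IsConfig

lemma serve_zero (l : List ℕ) : serve 0 l = l := by simp [serve]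

lemma serve_replicate (z x : ℕ) (l : List ℕ) :
    serve z (List.replicate z x ++ l) =
      List.replicate (if x - 1 = 0 then 0 else z) (x - 1) ++ l := by
  rw [serve, List.take_left' (by simp), List.drop_left' (by simp), List.map_replicate]
  split_ifs with hx
  · simp [hx]
  · simp [Nat.pos_of_ne_zero hx]

/-- One slot of the queueing model in terms of configurations. -/
lemma nextState_encode (h : IsConfig N p μ r u b) (s : Sched J K)
    {a : Fin J → Sched J K → ℕ} (ha : ∀ j t, a j t ≠ 0 → InUse p μ j t) :
    ∃ r' u' b', IsConfig N p μ r' u' b' ∧ nextState N (encode N r u b) s a = encode N r' u' b' ∧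
      (∀ t, t ≠ s → r' t = r t ∧ ∀ j, b' j t = b j t + a j t) ∧
      (r s ≠ 0 → r' s = r s - 1 ∧ ∀ j, b' j s = b j s + a j s) ∧
      (r s = 0 → r' s = (if ∀ j, min (s.num j) (b j s) = 0 then 0 else N s - 1) ∧
        ∀ j, b' j s = b j s - min (s.num j) (b j s) + a j s) := by
  classical
  have ha' : ∀ j t, b j t + a j t ≠ 0 → InUse p μ j t := by
    intro j t h0
    by_cases hb : b j t = 0
    · exact ha j t (by omega)
    · exact h.inUse j t (Or.inr hb)
  by_cases hr : r s = 0
  · set z : Fin J → ℕ := fun j => min (s.num j) (b j s) with hz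
    -- If `N s = 1` the scheduled messages leave at once: the new residual is 0, and accordingly the
    -- new `u` below is 0.
    set ρ : ℕ := if ∀ j, z j = 0 then 0 else N s - 1 with hρ
    refine ⟨fun t => if t = s then ρ else r t,
      fun j t => if t = s then (if N s - 1 = 0 then 0 else z j) else u j t,
      fun j t => if t = s then b j s - z j + a j s else b j t + a j t, ?_, ?_, ?_, ?_, ?_⟩
    · refine ⟨fun j t ht => ?_, fun j t => ?_, fun t ht j => ?_, fun t ht => ?_⟩
      · by_cases hts : t = s
        · subst hts
          simp only [if_true] at ht
          apply ha'
          rcases ht with ht | ht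
          · split_ifs at ht
            · exact absurd rfl ht
            · simp only [hz] at ht; omega
          · omega
        · simp only [if_neg hts] at ht
          rcases ht with ht | ht
          · exact h.inUse j t (Or.inl ht)
          · exact ha' j t ht
      · by_cases hts : t = s
        · subst hts
          simp only [if_true]
          split_ifs
          · exact Nat.zero_le _
          · exact min_le_left _ _
        · simpa only [if_neg hts] using h.le_num j t
      · by_cases hts : t = s
        · subst hts
          simp only [if_true] at ht ⊢
          rw [hρ] at ht
          by_cases hz0 : ∀ j, z j = 0
          · simp [hz0 j]
          · rw [if_neg hz0] at ht
            rw [if_pos ht]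
        · simp only [if_neg hts] at ht ⊢
          exact h.idle t ht j
      · by_cases hts : t = s
        · subst hts
          simp only [if_true] at ht ⊢
          rw [hρ] at ht ⊢
          by_cases hz0 : ∀ j, z j = 0
          · exact absurd (if_pos hz0) ht
          · rw [if_neg hz0] at ht ⊢
            push Not at hz0
            obtain ⟨j, hj⟩ := hz0
            exact ⟨by omega, j, by rw [if_neg ht]; exact hj⟩
        · simp only [if_neg hts] at ht ⊢
          exact h.busy t ht
    · funext j t
      rw [nextState, h.implemented_encode]
      by_cases hts : t = s
      · subst hts
        simp only [if_true, if_pos hr, encode, h.idle t hr j, List.replicate_zero, List.nil_append]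
        have hsplit : List.replicate (b j t) (N t)
            = List.replicate (z j) (N t) ++ List.replicate (b j t - z j) (N t) := by
          rw [← List.replicate_add]
          congr 1
          have : z j ≤ b j t := min_le_right _ _
          omega
        rw [hsplit, serve_replicate, List.append_assoc, ← List.replicate_add]
        congr 1
        by_cases hz0 : ∀ j, z j = 0
        · have hj : min (t.num j) (b j t) = 0 := hz0 j
          simp only [hj, hz, ite_self, List.replicate_zero]
        · rw [hρ, if_neg hz0]
      · simp only [if_neg hts, serve_zero, encode, List.append_assoc, ← List.replicate_add]
    · intro t hts
      simp [hts]
    · exact fun h0 => absurd hr h0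
    · intro _
      simp [hρ, hz]
  · refine ⟨fun t => if t = s then r s - 1 else r t,
      fun j t => if t = s then (if r s - 1 = 0 then 0 else u j s) else u j t,
      fun j t => b j t + a j t, ?_, ?_, ?_, ?_, ?_⟩
    · refine ⟨fun j t ht => ?_, fun j t => ?_, fun t ht j => ?_, fun t ht => ?_⟩
      · rcases ht with ht | ht
        · refine h.inUse j t (Or.inl ?_)
          by_cases hts : t = s
          · subst hts
            intro h0
            simp [h0] at ht
          · simpa [hts] using ht
        · exact ha' j t ht
      · by_cases hts : t = s
        · subst hts
          simp only [if_true]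
          split_ifs
          · exact Nat.zero_le _
          · exact h.le_num j t
        · simpa only [if_neg hts] using h.le_num j t
      · by_cases hts : t = s
        · subst hts
          simp only [if_true] at ht ⊢
          rw [if_pos ht]
        · simp only [if_neg hts] at ht ⊢
          exact h.idle t ht j
      · by_cases hts : t = s
        · subst hts
          simp only [if_true] at ht ⊢
          obtain ⟨hlt, j, hj⟩ := h.busy t hr
          exact ⟨by omega, j, by rw [if_neg ht]; exact hj⟩
        · simp only [if_neg hts] at ht ⊢
          exact h.busy t ht
    · funext j t
      rw [nextState, h.implemented_encode]
      by_cases hts : t = s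
      · subst hts
        simp only [if_true, if_neg hr, encode]
        rw [serve_replicate, List.append_assoc, ← List.replicate_add]
      · simp only [if_neg hts, serve_zero, encode, List.append_assoc, ← List.replicate_add]
    · intro t hts
      simp [hts]
    · intro _
      simp
    · exact fun h0 => absurd h0 hr

/-- The dynamics of residual requirements and numbers of fresh messages. -/
structure SlotDynamics (N : Sched J K → ℕ) (α α' : QState J K) (s : Sched J K)
    (a : Fin J → Sched J K → ℕ) : Prop where
  residual_other : ∀ t, t ≠ s → residualOf N α' t = residualOf N α t
  fresh_other : ∀ t, t ≠ s → ∀ j, fresh N α' j t = fresh N α j t + a j t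
  residual_busy : residualOf N α s ≠ 0 → residualOf N α' s = residualOf N α s - 1
  fresh_busy : residualOf N α s ≠ 0 → ∀ j, fresh N α' j s = fresh N α j s + a j s
  residual_idle : residualOf N α s = 0 → residualOf N α' s =
    if ∀ j, min (s.num j) (fresh N α j s) = 0 then 0 else N s - 1
  fresh_idle : residualOf N α s = 0 → ∀ j, fresh N α' j s =
    fresh N α j s - min (s.num j) (fresh N α j s) + a j s

lemma nextState_mem_and_dynamics (hN : PosLength N) {α : QState J K} (hα : α ∈ stateSpace N p μ)
    (s : Sched J K) {a : Fin J → Sched J K → ℕ} (ha : ∀ j t, a j t ≠ 0 → InUse p μ j t) :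
    nextState N α s a ∈ stateSpace N p μ ∧ SlotDynamics N α (nextState N α s a) s a := by
  obtain ⟨r, u, b, h, rfl⟩ := exists_config hα
  obtain ⟨r', u', b', h', heq, h1, h2, h3⟩ := nextState_encode h s ha
  rw [heq]
  refine ⟨encode_mem hN h', ⟨?_, ?_, ?_, ?_, ?_, ?_⟩⟩ <;>
    simp only [h.residual_encode, h'.residual_encode, h.fresh_encode, h'.fresh_encode]
  · exact fun t ht => (h1 t ht).1
  · exact fun t ht => (h1 t ht).2
  · exact fun hr => (h2 hr).1
  · exact fun hr => (h2 hr).2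
  · exact fun hr => (h3 hr).1
  · exact fun hr => (h3 hr).2

/-! ### Bounds for workloads and numbers of messages; finiteness of sublevel sets. -/

variable {α : QState J K}

lemma fresh_le_length (N : Sched J K → ℕ) (α : QState J K) (j : Fin J) (s : Sched J K) :
    fresh N α j s ≤ (α j s).length := List.countP_le_length

lemma residual_lt (hα : α ∈ stateSpace N p μ) (s : Sched J K) : residualOf N α s ≤ N s := by
  obtain ⟨r, u, b, h, rfl⟩ := exists_config hα
  rw [h.residual_encode]
  by_cases hr : r s = 0
  · simp [hr]
  · exact (h.busy s hr).1.le

lemma eq_replicate_of_residual (hα : α ∈ stateSpace N p μ) {s : Sched J K}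
    (hr : residualOf N α s = 0) (j : Fin J) : α j s = List.replicate (fresh N α j s) (N s) := by
  obtain ⟨r, u, b, h, rfl⟩ := exists_config hα
  rw [h.residual_encode] at hr
  rw [h.fresh_encode, encode, h.idle s hr j, List.replicate_zero, List.nil_append]

lemma inUse_of_fresh (hα : α ∈ stateSpace N p μ) {j : Fin J} {s : Sched J K}
    (h : fresh N α j s ≠ 0) : InUse p μ j s := by
  refine hα.1 j s fun h0 => h ?_
  simp [fresh, h0]

lemma exists_inUse_of_residual (hα : α ∈ stateSpace N p μ) {s : Sched J K}
    (hr : residualOf N α s ≠ 0) : ∃ j, InUse p μ j s := by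
  obtain ⟨r, u, b, h, rfl⟩ := exists_config hα
  rw [h.residual_encode] at hr
  obtain ⟨-, j, hj⟩ := h.busy s hr
  exact ⟨j, h.inUse j s (Or.inl hj)⟩

lemma length_le_workload (hN : PosLength N) (hα : α ∈ stateSpace N p μ) (j : Fin J)
    (s : Sched J K) : (α j s).length ≤ workload N α j s := by
  obtain ⟨r, u, b, h, rfl⟩ := exists_config hα
  have hlen : (encode N r u b j s).length = u j s + b j s := by simp [encode]
  rw [workload, h.fresh_encode, hlen]
  have hb : b j s ≤ N s * b j s := by
    by_cases hb : b j s = 0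
    · simp [hb]
    · exact Nat.le_mul_of_pos_left _ (hN s j (h.inUse j s (Or.inr hb)).1)
  cases hu : u j s with
  | zero => simpa using hb
  | succ k =>
    have hne : u j s ≠ 0 := by omega
    have hle := h.le_num j s
    have hr := (h.lt_of_ne hne).1
    rw [if_pos (by omega)]
    simp only [encode, hu, List.replicate_succ, List.cons_append, List.headD_cons]
    have : s.num j ≤ s.num j * r s := Nat.le_mul_of_pos_right _ hr
    omega

/-- The two differ only if s is being transmitted without a message from the queue (j, s): then only
the full workload counts s_j times the residual. -/
lemma workload_le_fullWorkload (hα : α ∈ stateSpace N p μ) (j : Fin J) (s : Sched J K) :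
    workload N α j s ≤ fullWorkload N α j s := by
  obtain ⟨r, u, b, h, rfl⟩ := exists_config hα
  rw [workload, fullWorkload, h.residual_encode]
  refine Nat.add_le_add_left ?_ _
  split_ifs with hlt
  · rw [h.fresh_encode] at hlt
    cases hu : u j s with
    | zero => simp [encode, hu] at hlt
    | succ k => simp [encode, hu, List.replicate_succ]
  · exact Nat.zero_le _

lemma numMessages_le (hN : PosLength N) (hα : α ∈ stateSpace N p μ) :
    (numMessages α : ℝ≥0∞) ≤ queueCost N α := by
  rw [queueCost, Nat.cast_le, numMessages]
  refine le_trans ?_ (Nat.le_add_left _ 1)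
  exact Finset.sum_le_sum fun j _ => Finset.sum_le_sum fun s _ => length_le_workload hN hα j s

/-- A state is determined by residuals, transmitted numbers and fresh numbers. The transmitted
numbers are at most K; a non-zero residual comes with some j such that s_j ≥ 1, and non-zero fresh
numbers with N(s) ≥ 1, so B bounds both. -/
lemma finite_fullWorkload_le (hN : PosLength N) (B : ℕ) :
    {α | α ∈ stateSpace N p μ ∧ ∀ j s, fullWorkload N α j s ≤ B}.Finite := by
  have hfin : (Set.Iic (fun _ : Sched J K => B) ×ˢ
      (Set.Iic (fun (_ : Fin J) (_ : Sched J K) => K) ×ˢ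
        Set.Iic (fun (_ : Fin J) (_ : Sched J K) => B))).Finite :=
    (Set.finite_Iic _).prod ((Set.finite_Iic _).prod (Set.finite_Iic _))
  refine (hfin.image fun x => encode N x.1 x.2.1 x.2.2).subset ?_
  rintro α ⟨hα, hB⟩
  obtain ⟨r, u, b, h, rfl⟩ := exists_config hα
  simp only [fullWorkload, h.residual_encode, h.fresh_encode] at hB
  refine ⟨(r, u, b), ⟨fun s => ?_, fun j s => ?_, fun j s => ?_⟩, rfl⟩
  · show r s ≤ B
    by_cases hr : r s = 0
    · simp [hr]
    · obtain ⟨-, j, hj⟩ := h.busy s hr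
      have h1 := (h.inUse j s (Or.inl hj)).1
      have h2 : r s ≤ s.num j * r s := Nat.le_mul_of_pos_left _ h1
      have := hB j s
      omega
  · exact (h.le_num j s).trans (Nat.lt_succ_iff.1 (s.1 j).2)
  · show b j s ≤ B
    by_cases hb : b j s = 0
    · simp [hb]
    · have h1 := hN s j (h.inUse j s (Or.inr hb)).1
      have h2 : b j s ≤ N s * b j s := Nat.le_mul_of_pos_left _ h1
      have := hB j s
      omega

end Dynamics

/-! ### Drift of the workloads -/

section Drift

variable {J K : ℕ} {N : Sched J K → ℕ} {p : PMF (Sched J K)} {μ : Fin J → PMF (Sched J K)}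
  {A : Fin J → PMF ℕ} {lam : Fin J → ℝ≥0}

lemma mean_queueChain (N : Sched J K → ℕ) (p : PMF (Sched J K)) (μ : Fin J → PMF (Sched J K))
    (A : Fin J → PMF ℕ) (α : QState J K) (F : QState J K → ℝ≥0∞) :
    mean (queueChain N p μ A α) F =
      mean p fun d => mean (arrivalLaw A μ) fun a => F (nextState N α d a) := by
  rw [queueChain, mean_bind]
  simp only [mean_map]

lemma canStep_iff {α α' : QState J K} : CanStep (queueChain N p μ A) α α' ↔
    ∃ d a, p d ≠ 0 ∧ arrivalLaw A μ a ≠ 0 ∧ α' = nextState N α d a := by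
  rw [CanStep, queueChain, ← PMF.mem_support_iff, PMF.mem_support_bind_iff]
  constructor
  · rintro ⟨d, hd, h⟩
    obtain ⟨a, ha, rfl⟩ := (PMF.mem_support_map_iff _ _ _).1 h
    exact ⟨d, a, hd, ha, rfl⟩
  · rintro ⟨d, a, hd, ha, rfl⟩
    exact ⟨d, hd, (PMF.mem_support_map_iff _ _ _).2 ⟨a, ha, rfl⟩⟩

lemma inUse_of_arrival (hμ : IsSplitting μ) (hA : HasRates A lam) {a : Fin J → Sched J K → ℕ}
    (ha : arrivalLaw A μ a ≠ 0) (j : Fin J) (t : Sched J K) (h : a j t ≠ 0) : InUse p μ j t := by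
  have h' := splitting_ne_zero_of_arrival hA ha h
  exact ⟨hμ j t h', Or.inr h'⟩

lemma isClosedOn_stateSpace (hN : PosLength N) (hμ : IsSplitting μ) (hA : HasRates A lam) :
    IsClosedOn (queueChain N p μ A) (stateSpace N p μ) := by
  intro α hα α' h
  obtain ⟨d, a, -, ha, rfl⟩ := canStep_iff.1 h
  exact (nextState_mem_and_dynamics hN hα d (inUse_of_arrival hμ hA ha)).1

/-- The change of a workload in one slot: `D` is the service and `x` the new work; the second
alternative occurs when a transmission starts with fewer messages than the schedule allows. -/
lemma fullWorkload_step (hN : PosLength N) {α α' : QState J K} {d : Sched J K}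
    {a : Fin J → Sched J K → ℕ} (h : SlotDynamics N α α' d a) (j : Fin J) (t : Sched J K) :
    fullWorkload N α' j t + (if d = t then t.num j else 0) = fullWorkload N α j t + N t * a j t ∨
    (fullWorkload N α j t ≤ N t * t.num j ∧
      fullWorkload N α' j t ≤ N t * t.num j + N t * a j t ∧
      fullWorkload N α j t + N t * a j t ≤
        fullWorkload N α' j t + (if d = t then t.num j else 0)) := by
  unfold fullWorkload
  by_cases hdt : d = t
  · subst hdt
    rw [if_pos rfl]
    by_cases hr : residualOf N α d = 0
    · rw [h.fresh_idle hr, h.residual_idle hr, hr]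
      by_cases hz : ∀ i, min (d.num i) (fresh N α i d) = 0
      · rw [if_pos hz, hz j]
        have hj := hz j
        rcases Nat.eq_zero_or_pos (d.num j) with hd | hd
        · left; rw [hd]; simp; ring
        · have hf : fresh N α j d = 0 := by omega
          right
          rw [hf]
          simp
      · rw [if_neg hz]
        push Not at hz
        obtain ⟨i, hi⟩ := hz
        have hNd : 1 ≤ N d := hN d i (by omega)
        obtain ⟨n, hn⟩ := Nat.exists_eq_add_of_le' hNd
        rw [hn, Nat.add_sub_cancel]
        rcases le_total (d.num j) (fresh N α j d) with hle | hle
        -- A full start: N(s)(s_j + k) becomes N(s) k + s_j (N(s) - 1), exactly s_j less.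
        · obtain ⟨k, hk⟩ := Nat.exists_eq_add_of_le hle
          left
          rw [min_eq_left hle, hk, Nat.add_sub_cancel_left]
          ring
        -- A start with k messages too few: H' + s_j equals N(s) s_j plus the new work, whereas H is
        -- only N(s) times the fresh number.
        · obtain ⟨k, hk⟩ := Nat.exists_eq_add_of_le hle
          right
          rw [min_eq_right hle, Nat.sub_self, hk]
          refine ⟨?_, ?_, ?_⟩ <;> ring_nf <;> nlinarith [Nat.zero_le (n * k)]
    · rw [h.fresh_busy hr, h.residual_busy hr]
      obtain ⟨n, hn⟩ := Nat.exists_eq_succ_of_ne_zero hr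
      left
      rw [hn, Nat.succ_eq_add_one, Nat.add_sub_cancel]
      ring
  · rw [if_neg hdt, h.fresh_other t (Ne.symm hdt), h.residual_other t (Ne.symm hdt)]
    left
    ring

lemma fullWorkload_lower (hN : PosLength N) {α α' : QState J K} {d : Sched J K}
    {a : Fin J → Sched J K → ℕ} (h : SlotDynamics N α α' d a) (j : Fin J) (t : Sched J K) :
    fullWorkload N α j t + N t * a j t ≤
      fullWorkload N α' j t + (if d = t then t.num j else 0) := by
  rcases fullWorkload_step hN h j t with h | h
  · exact h.ge
  · exact h.2.2

/-- In the exact case, expand (H + x - D)² and use (x - D)² ≤ x² + s_j². In the exceptional case H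
and H' - x are bounded by N(s) s_j, and everything but the terms in x goes into the constant. -/
lemma fullWorkload_sq (hN : PosLength N) {α α' : QState J K} {d : Sched J K}
    {a : Fin J → Sched J K → ℕ} (h : SlotDynamics N α α' d a) (j : Fin J) (t : Sched J K) :
    fullWorkload N α' j t ^ 2 + 2 * fullWorkload N α j t * (if d = t then t.num j else 0) ≤
      fullWorkload N α j t ^ 2 + 2 * fullWorkload N α j t * (N t * a j t) +
        2 * (N t * a j t) ^ 2 +
        (2 * (N t * t.num j) ^ 2 + 2 * t.num j * (N t * t.num j) + t.num j ^ 2) := by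
  have hD : (if d = t then t.num j else 0) ≤ t.num j := by split_ifs <;> simp
  rcases fullWorkload_step hN h j t with h | ⟨h1, h2, -⟩
  · generalize (if d = t then t.num j else 0) = D at *
    generalize fullWorkload N α' j t = H' at *
    generalize fullWorkload N α j t = H at *
    generalize N t * a j t = x at *
    generalize N t * t.num j = B at *
    generalize t.num j = s at *
    zify at *
    have hH' : (H' : ℤ) = H + x - D := by linarith
    rw [hH']
    have hD2 : (D : ℤ) ^ 2 ≤ s ^ 2 := by gcongr
    have hxD : (0 : ℤ) ≤ x * D := by positivity
    have hB : (0 : ℤ) ≤ s * B := by positivity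
    nlinarith [sq_nonneg (x : ℤ), sq_nonneg (B : ℤ)]
  · generalize (if d = t then t.num j else 0) = D at *
    generalize fullWorkload N α' j t = H' at *
    generalize fullWorkload N α j t = H at *
    generalize N t * a j t = x at *
    generalize N t * t.num j = B at *
    generalize t.num j = s at *
    have h3 : H' ^ 2 ≤ (B + x) ^ 2 := by gcongr
    have h4 : (B + x) ^ 2 ≤ 2 * B ^ 2 + 2 * x ^ 2 := by
      zify
      nlinarith [sq_nonneg ((B : ℤ) - x)]
    have h5 : 2 * H * D ≤ 2 * B * s := by gcongr
    have h6 : 0 ≤ 2 * H * x := Nat.zero_le _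
    nlinarith

lemma mean_draw (p : PMF (Sched J K)) (t : Sched J K) (c : ℝ≥0∞) :
    mean p (fun d => if d = t then c else 0) = p t * c := by
  rw [mean, tsum_eq_single t]
  · simp
  · intro d hd; simp [hd]

lemma mean_fullWorkload_sq (hN : PosLength N) (hμ : IsSplitting μ) (hA : HasRates A lam)
    (j : Fin J) (t : Sched J K) : ∃ κ : ℝ≥0∞, κ ≠ ∞ ∧ ∀ α ∈ stateSpace N p μ,
      mean (queueChain N p μ A α) (fun α' => (fullWorkload N α' j t : ℝ≥0∞) ^ 2) +
          2 * fullWorkload N α j t * (p t * t.num j) ≤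
        (fullWorkload N α j t : ℝ≥0∞) ^ 2 +
          2 * fullWorkload N α j t * (N t * (lam j * μ j t)) + κ := by
  set m2 := mean (arrivalLaw A μ) (fun a => (a j t : ℝ≥0∞) ^ 2) with hm2
  set κ0 : ℕ := 2 * (N t * t.num j) ^ 2 + 2 * t.num j * (N t * t.num j) + t.num j ^ 2 with hκ0
  refine ⟨2 * (N t : ℝ≥0∞) ^ 2 * m2 + κ0, ?_, ?_⟩
  · refine ENNReal.add_ne_top.2 ⟨ENNReal.mul_ne_top ?_ (mean_arrivals_sq_lt_top hA μ j t).ne, ?_⟩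
    · exact ENNReal.mul_ne_top (by simp) (by simp)
    · exact ENNReal.natCast_ne_top _
  intro α hα
  set H := fullWorkload N α j t with hH
  have hL : mean (queueChain N p μ A α) (fun α' => (fullWorkload N α' j t : ℝ≥0∞) ^ 2) +
      2 * H * (p t * t.num j) = mean p fun d => mean (arrivalLaw A μ) fun a =>
        (fullWorkload N (nextState N α d a) j t : ℝ≥0∞) ^ 2 +
          2 * H * (if d = t then (t.num j : ℝ≥0∞) else 0) := by
    simp only [mean_add, mean_const, mean_const_mul, mean_draw, mean_queueChain]
  have hR : (H : ℝ≥0∞) ^ 2 + 2 * H * (N t * (lam j * μ j t)) +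
      (2 * (N t : ℝ≥0∞) ^ 2 * m2 + κ0) = mean p fun d => mean (arrivalLaw A μ) fun a =>
        (H : ℝ≥0∞) ^ 2 + (2 * H * N t) * a j t + (2 * (N t : ℝ≥0∞) ^ 2) * (a j t : ℝ≥0∞) ^ 2
          + κ0 := by
    simp only [mean_add, mean_const, mean_const_mul, mean_arrivals hA]
    rw [← hm2]
    ring
  rw [hL, hR]
  refine mean_mono fun d => mean_mono_support fun a ha => ?_
  have h := fullWorkload_sq hN
    (nextState_mem_and_dynamics hN hα d (inUse_of_arrival hμ hA ha)).2 j t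
  have h' := (Nat.cast_le (α := ℝ≥0∞)).2 h
  rw [← hH, ← hκ0] at h'
  refine le_trans (le_of_eq ?_) (h'.trans (le_of_eq ?_))
  · push_cast
    rfl
  · push_cast
    ring

/-- The drift condition under the hypothesis that the mean service exceeds the mean arriving work. -/
lemma exists_drift (hN : PosLength N) (hμ : IsSplitting μ) (hA : HasRates A lam)
    (hstab : ∀ j s, InUse p μ j s →
      (N s : ℝ) * ((lam j : ℝ) * (μ j s).toReal) < (p s).toReal * (s.num j : ℝ)) :
    ∃ (M : ℕ) (b : ℝ≥0∞), b ≠ ∞ ∧ ∀ α ∈ stateSpace N p μ,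
      mean (queueChain N p μ A α)
          (fun α' => ∑ j, ∑ s, M * (fullWorkload N α' j s : ℝ≥0∞) ^ 2) +
        queueCost N α + ∑ j, ∑ s, (fullWorkload N α j s : ℝ≥0∞) ≤
      (∑ j, ∑ s, M * (fullWorkload N α j s : ℝ≥0∞) ^ 2) + b := by
  -- M magnifies the finitely many positive gaps between mean service and mean new work to at least
  -- 1. Each square then yields the drift -2H: one H pays for the cost, the other remains as
  -- negative drift.
  have hM : ∃ M : ℕ, ∀ j s, InUse p μ j s →
      (M : ℝ≥0∞) * (N s * (lam j * μ j s)) + 1 ≤ M * (p s * s.num j) := by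
    have h1 : ∀ j s, ∃ M : ℕ, InUse p μ j s →
        ∀ M' : ℕ, M ≤ M' → (M' : ℝ≥0∞) * (N s * (lam j * μ j s)) + 1 ≤ M' * (p s * s.num j) := by
      intro j s
      by_cases hu : InUse p μ j s
      · have hlt := hstab j s hu
        obtain ⟨M, hM⟩ := exists_nat_ge
          (1 / ((p s).toReal * (s.num j : ℝ) - (N s : ℝ) * ((lam j : ℝ) * (μ j s).toReal)))
        refine ⟨M, fun _ M' hM' => ?_⟩
        have hfin1 : (N s : ℝ≥0∞) * (lam j * μ j s) ≠ ∞ :=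
          ENNReal.mul_ne_top (by simp) (ENNReal.mul_ne_top (by simp) ((μ j).apply_ne_top s))
        have hfin2 : p s * (s.num j : ℝ≥0∞) ≠ ∞ :=
          ENNReal.mul_ne_top (p.apply_ne_top s) (by simp)
        have hf1 : (M' : ℝ≥0∞) * (N s * (lam j * μ j s)) ≠ ∞ := ENNReal.mul_ne_top (by simp) hfin1
        have hf2 : (M' : ℝ≥0∞) * (p s * s.num j) ≠ ∞ := ENNReal.mul_ne_top (by simp) hfin2
        rw [← ENNReal.toReal_le_toReal (ENNReal.add_ne_top.2 ⟨hf1, by simp⟩) hf2,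
          ENNReal.toReal_add hf1 (by simp)]
        simp only [ENNReal.toReal_mul, ENNReal.toReal_natCast, ENNReal.coe_toReal,
          ENNReal.toReal_one]
        rw [div_le_iff₀ (by linarith)] at hM
        have hMM : (M : ℝ) ≤ M' := by exact_mod_cast hM'
        nlinarith
      · exact ⟨0, fun h => absurd h hu⟩
    choose M hM using h1
    refine ⟨∑ j, ∑ s, M j s, fun j s hu => hM j s hu _ ?_⟩
    exact (Finset.single_le_sum (f := fun s => M j s) (fun _ _ => Nat.zero_le _)
      (Finset.mem_univ s)).trans (Finset.single_le_sum (f := fun j => ∑ s, M j s)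
      (fun _ _ => Nat.zero_le _) (Finset.mem_univ j))
  obtain ⟨M, hM⟩ := hM
  choose κ hκ hstep using mean_fullWorkload_sq (p := p) hN hμ hA
  refine ⟨M, 1 + ∑ j, ∑ s, M * κ j s, ?_, fun α hα => ?_⟩
  · refine ENNReal.add_ne_top.2 ⟨by simp, ?_⟩
    exact ENNReal.sum_ne_top.2 fun j _ => ENNReal.sum_ne_top.2 fun s _ =>
      ENNReal.mul_ne_top (by simp) (hκ j s)
  have hjs : ∀ j s, mean (queueChain N p μ A α)
      (fun α' => M * (fullWorkload N α' j s : ℝ≥0∞) ^ 2) + 2 * fullWorkload N α j s ≤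
      M * (fullWorkload N α j s : ℝ≥0∞) ^ 2 + M * κ j s := by
    intro j s
    have hst := hstep j s α hα
    rw [mean_const_mul]
    set E := mean (queueChain N p μ A α) (fun α' => (fullWorkload N α' j s : ℝ≥0∞) ^ 2)
    by_cases hH : fullWorkload N α j s = 0
    · rw [hH] at hst ⊢
      simp only [Nat.cast_zero, mul_zero, zero_mul, add_zero] at hst ⊢
      rw [← mul_add]
      gcongr
    -- H_{js} may be positive only because s is being transmitted for another class i. Then (i, s)
    -- is in use, so p(s) > 0 by the load condition, and (j, s) is in use as well.
    · have hu : InUse p μ j s := by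
        by_cases hf : fresh N α j s = 0
        · have hne : s.num j ≠ 0 ∧ residualOf N α s ≠ 0 := by
            rw [fullWorkload, hf, mul_zero, zero_add] at hH
            exact mul_ne_zero_iff.1 hH
          obtain ⟨i, hi⟩ := exists_inUse_of_residual hα hne.2
          refine ⟨Nat.pos_of_ne_zero hne.1, Or.inl fun hp => ?_⟩
          have := hstab i s hi
          rw [hp, ENNReal.toReal_zero, zero_mul] at this
          have h0 : (0 : ℝ) ≤ (N s : ℝ) * ((lam i : ℝ) * (μ i s).toReal) := by positivity
          linarith
        · exact inUse_of_fresh hα hf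
      have hMu := hM j s hu
      set H : ℝ≥0∞ := (fullWorkload N α j s : ℝ≥0∞) with hHdef
      have hHt : H ≠ ∞ := ENNReal.natCast_ne_top _
      have hfin : 2 * H * (M * (N s * (lam j * μ j s))) ≠ ∞ :=
        ENNReal.mul_ne_top (ENNReal.mul_ne_top (by simp) hHt) (ENNReal.mul_ne_top (by simp)
          (ENNReal.mul_ne_top (by simp) (ENNReal.mul_ne_top (by simp) ((μ j).apply_ne_top s))))
      refine (ENNReal.add_le_add_iff_right hfin).1 ?_
      calc M * E + 2 * H + 2 * H * (M * (N s * (lam j * μ j s)))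
          = M * E + 2 * H * (M * (N s * (lam j * μ j s)) + 1) := by ring
        _ ≤ M * E + 2 * H * (M * (p s * s.num j)) := by gcongr
        _ = M * (E + 2 * H * (p s * s.num j)) := by ring
        _ ≤ M * (H ^ 2 + 2 * H * (N s * (lam j * μ j s)) + κ j s) := by gcongr
        _ = _ := by ring
  have hcost : queueCost N α ≤ 1 + ∑ j, ∑ s, (fullWorkload N α j s : ℝ≥0∞) := by
    rw [queueCost]
    push_cast
    gcongr
    exact workload_le_fullWorkload hα _ _
  have hsum := Finset.sum_le_sum fun j (_ : j ∈ Finset.univ) =>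
    Finset.sum_le_sum fun s (_ : s ∈ Finset.univ) => hjs j s
  simp only [Finset.sum_add_distrib, ← Finset.mul_sum] at hsum
  simp only [mean_sum, mean_const_mul, ← Finset.mul_sum] at hsum ⊢
  refine (add_le_add_left (add_le_add_right hcost _) _).trans ?_
  refine le_trans (le_of_eq ?_) ((add_le_add_left hsum 1).trans (le_of_eq ?_))
  · ring
  · ring

/-- `c`-regularity, provided that any finite set of states leads to a common state. -/
theorem isCRegularOn_queue (hN : PosLength N) (hμ : IsSplitting μ) (hA : HasRates A lam)
    (hstab : ∀ j s, InUse p μ j s →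
      (N s : ℝ) * ((lam j : ℝ) * (μ j s).toReal) < (p s).toReal * (s.num j : ℝ))
    (hreach : ∀ C ⊆ stateSpace N p μ, C.Finite → ∃ y ∈ stateSpace N p μ,
      ∀ x ∈ C, Relation.TransGen (CanStep (queueChain N p μ A)) x y) :
    IsCRegularOn (queueChain N p μ A) (stateSpace N p μ) (queueCost N) := by
  classical
  obtain ⟨M, b, hb, hdrift⟩ := exists_drift hN hμ hA hstab
  -- Off the finite set where all workloads are at most B, the spare sum of the workloads exceeds b
  -- and absorbs it.
  obtain ⟨B, hB⟩ := ENNReal.exists_nat_gt hb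
  have hfin := finite_fullWorkload_le (p := p) (μ := μ) hN B
  obtain ⟨y, hy, hxy⟩ := hreach _ (fun α hα => hα.1) hfin
  refine isCRegularOn_of_drift (V := fun α => ∑ j, ∑ s, M * (fullWorkload N α j s : ℝ≥0∞) ^ 2)
    (b := b) (isClosedOn_stateSpace hN hμ hA) hfin hb ?_ ?_ hy hxy
  · intro α _
    exact ENNReal.sum_ne_top.2 fun j _ => ENNReal.sum_ne_top.2 fun s _ =>
      ENNReal.mul_ne_top (by simp) (by simp)
  · intro α hα
    have h := hdrift α hα
    split_ifs with hC
    · exact (le_add_of_nonneg_right (zero_le)).trans h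
    · refine (ENNReal.add_le_add_iff_right hb).1 ?_
      rw [add_zero]
      refine le_trans ?_ h
      gcongr
      have hex : ∃ j s, B < fullWorkload N α j s := by
        by_contra! hall
        exact hC ⟨hα, hall⟩
      obtain ⟨j, s, hjs⟩ := hex
      calc b ≤ B := hB.le
        _ ≤ (fullWorkload N α j s : ℝ≥0∞) := by exact_mod_cast hjs.le
        _ ≤ ∑ s, (fullWorkload N α j s : ℝ≥0∞) :=
          Finset.single_le_sum (f := fun s => (fullWorkload N α j s : ℝ≥0∞))
            (fun _ _ => zero_le) (Finset.mem_univ s)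
        _ ≤ _ := Finset.single_le_sum (f := fun j => ∑ s, (fullWorkload N α j s : ℝ≥0∞))
            (fun _ _ => zero_le) (Finset.mem_univ j)

end Drift

/-! ### Transience -/

section Transience

lemma exp_neg_add_le {x : ℝ} (hx : 0 ≤ x) : Real.exp (-x) + x ≤ 1 + x ^ 2 := by
  rcases le_total x 1 with h1 | h1
  · have h := Real.abs_exp_sub_one_sub_id_le (x := -x) (by rwa [abs_neg, abs_of_nonneg hx])
    have := (abs_le.1 h).2
    nlinarith
  · have : Real.exp (-x) ≤ 1 := Real.exp_le_one_iff.2 (by linarith)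
    nlinarith

lemma exp_le_of_le_one {x : ℝ} (hx : 0 ≤ x) (h1 : x ≤ 1) : Real.exp x ≤ 1 + x + x ^ 2 := by
  have h := Real.abs_exp_sub_one_sub_id_le (x := x) (by rwa [abs_of_nonneg hx])
  have := (abs_le.1 h).2
  linarith

/-- The Laplace transform of a non-negative integer random variable near zero. -/
lemma mean_exp_neg_le {X : Type*} (q : PMF X) (f : X → ℕ) {ε : ℝ} (hε : 0 ≤ ε)
    (h1 : mean q (fun x => (f x : ℝ≥0∞)) ≠ ∞) (h2 : mean q (fun x => (f x : ℝ≥0∞) ^ 2) ≠ ∞) :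
    mean q (fun x => ENNReal.ofReal (Real.exp (-(ε * f x)))) ≤
      ENNReal.ofReal (Real.exp (-(ε * (mean q fun x => (f x : ℝ≥0∞)).toReal) +
        ε ^ 2 * (mean q fun x => (f x : ℝ≥0∞) ^ 2).toReal)) := by
  set Φ := mean q (fun x => ENNReal.ofReal (Real.exp (-(ε * f x)))) with hΦ
  set m1 := mean q (fun x => (f x : ℝ≥0∞)) with hm1
  set m2 := mean q (fun x => (f x : ℝ≥0∞) ^ 2) with hm2
  have hΦ1 : Φ ≤ 1 := by
    refine (mean_mono (g := fun _ => 1) fun x => ?_).trans (mean_const _ _).le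
    rw [ENNReal.ofReal_le_one, Real.exp_le_one_iff, neg_nonpos]
    positivity
  have hΦt : Φ ≠ ∞ := ne_top_of_le_ne_top ENNReal.one_ne_top hΦ1
  have key : Φ + ENNReal.ofReal ε * m1 ≤ 1 + ENNReal.ofReal (ε ^ 2) * m2 := by
    rw [hΦ, hm1, hm2, ← mean_const_mul, ← mean_const_mul, ← mean_add, ← mean_const q 1, ← mean_add]
    refine mean_mono fun x => ?_
    have h := exp_neg_add_le (x := ε * f x) (by positivity)
    rw [← ENNReal.ofReal_natCast (f x), ← ENNReal.ofReal_mul hε,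
      ← ENNReal.ofReal_pow (Nat.cast_nonneg _), ← ENNReal.ofReal_mul (by positivity),
      ← ENNReal.ofReal_one, ← ENNReal.ofReal_add (Real.exp_pos _).le (by positivity),
      ← ENNReal.ofReal_add one_pos.le (by positivity), ← mul_pow]
    exact ENNReal.ofReal_le_ofReal h
  have hf1 : ENNReal.ofReal ε * m1 ≠ ∞ := ENNReal.mul_ne_top ENNReal.ofReal_ne_top h1
  have hf2 : ENNReal.ofReal (ε ^ 2) * m2 ≠ ∞ := ENNReal.mul_ne_top ENNReal.ofReal_ne_top h2
  rw [← ENNReal.toReal_le_toReal (ENNReal.add_ne_top.2 ⟨hΦt, hf1⟩)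
    (ENNReal.add_ne_top.2 ⟨ENNReal.one_ne_top, hf2⟩), ENNReal.toReal_add hΦt hf1,
    ENNReal.toReal_add ENNReal.one_ne_top hf2, ENNReal.toReal_mul, ENNReal.toReal_mul,
    ENNReal.toReal_ofReal hε, ENNReal.toReal_ofReal (by positivity), ENNReal.toReal_one] at key
  rw [← ENNReal.ofReal_toReal hΦt]
  refine ENNReal.ofReal_le_ofReal ?_
  have := Real.add_one_le_exp (-(ε * m1.toReal) + ε ^ 2 * m2.toReal)
  linarith

variable {J K : ℕ} {N : Sched J K → ℕ} {p : PMF (Sched J K)} {μ : Fin J → PMF (Sched J K)}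
  {A : Fin J → PMF ℕ} {lam : Fin J → ℝ≥0}

/-- The potential service is c with probability p(s) and 0 otherwise; combine e^x ≤ 1 + x + x² for 0
≤ x ≤ 1 with 1 + y ≤ e^y. -/
lemma mean_exp_draw_le (p : PMF (Sched J K)) (s : Sched J K) (c : ℕ) {ε : ℝ} (hε : 0 ≤ ε)
    (hεc : ε * c ≤ 1) :
    mean p (fun d => ENNReal.ofReal (Real.exp (ε * (if d = s then c else 0 : ℕ)))) ≤
      ENNReal.ofReal (Real.exp (ε * ((p s).toReal * c) + ε ^ 2 * (c : ℝ) ^ 2)) := by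
  have hps1 : (p s).toReal ≤ 1 := ENNReal.toReal_mono ENNReal.one_ne_top (p.coe_le_one s)
  have h : ∀ d, ENNReal.ofReal (Real.exp (ε * (if d = s then c else 0 : ℕ))) ≤
      1 + (if d = s then ENNReal.ofReal (ε * c + (ε * c) ^ 2) else 0) := by
    intro d
    split_ifs with hd
    · rw [← ENNReal.ofReal_one, ← ENNReal.ofReal_add one_pos.le (by positivity)]
      refine ENNReal.ofReal_le_ofReal ?_
      have := exp_le_of_le_one (x := ε * c) (by positivity) hεc
      linarith
    · simp
  refine (mean_mono h).trans ?_
  have hps : p s * ENNReal.ofReal (ε * c + (ε * c) ^ 2) =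
      ENNReal.ofReal ((p s).toReal * (ε * c + (ε * c) ^ 2)) := by
    rw [ENNReal.ofReal_mul ENNReal.toReal_nonneg, ENNReal.ofReal_toReal (p.apply_ne_top s)]
  rw [mean_add, mean_const, mean_draw, hps, ← ENNReal.ofReal_one,
    ← ENNReal.ofReal_add one_pos.le (by positivity)]
  refine ENNReal.ofReal_le_ofReal ?_
  have h1 := Real.add_one_le_exp (ε * ((p s).toReal * c) + ε ^ 2 * (c : ℝ) ^ 2)
  have h2 : (p s).toReal * (ε * c) ^ 2 ≤ 1 * (ε * c) ^ 2 := by gcongr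
  nlinarith

/-- Transience if the mean arriving work exceeds the mean service in one of the queues. -/
theorem isTransientOn_queue (hN : PosLength N) (hμ : IsSplitting μ) (hA : HasRates A lam)
    {j : Fin J} {s : Sched J K}
    (hlt : (p s).toReal * (s.num j : ℝ) < (N s : ℝ) * ((lam j : ℝ) * (μ j s).toReal)) :
    IsTransientOn (queueChain N p μ A) (stateSpace N p μ) := by
  have hx : (fun a : Fin J → Sched J K → ℕ => ((N s * a j s : ℕ) : ℝ≥0∞)) =
      fun a => (N s : ℝ≥0∞) * a j s := by
    funext a; push_cast; rfl
  have hx2 : (fun a : Fin J → Sched J K → ℕ => ((N s * a j s : ℕ) : ℝ≥0∞) ^ 2) =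
      fun a => (N s : ℝ≥0∞) ^ 2 * (a j s : ℝ≥0∞) ^ 2 := by
    funext a; push_cast; ring
  have hm1 : mean (arrivalLaw A μ) (fun a => ((N s * a j s : ℕ) : ℝ≥0∞)) =
      N s * (lam j * μ j s) := by
    rw [hx, mean_const_mul, mean_arrivals hA]
  have hm1t : mean (arrivalLaw A μ) (fun a => ((N s * a j s : ℕ) : ℝ≥0∞)) ≠ ∞ := by
    rw [hm1]
    exact ENNReal.mul_ne_top (by simp) (ENNReal.mul_ne_top (by simp) ((μ j).apply_ne_top s))
  have hm2t : mean (arrivalLaw A μ) (fun a => ((N s * a j s : ℕ) : ℝ≥0∞) ^ 2) ≠ ∞ := by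
    rw [hx2, mean_const_mul]
    exact ENNReal.mul_ne_top (by simp) (mean_arrivals_sq_lt_top hA μ j s).ne
  have hm1r : (mean (arrivalLaw A μ) (fun a => ((N s * a j s : ℕ) : ℝ≥0∞))).toReal =
      (N s : ℝ) * ((lam j : ℝ) * (μ j s).toReal) := by
    rw [hm1]; simp
  set w : ℝ := (N s : ℝ) * ((lam j : ℝ) * (μ j s).toReal) with hw
  set v : ℝ := (p s).toReal * (s.num j : ℝ) with hv
  set m2 : ℝ := (mean (arrivalLaw A μ) (fun a => ((N s * a j s : ℕ) : ℝ≥0∞) ^ 2)).toReal with hm2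
  have hm2n : 0 ≤ m2 := ENNReal.toReal_nonneg
  -- The mean of exp(-ε(x - D)) is at most exp(-ε(w - v) + ε²(m2 + s_j²)); the last condition makes
  -- this exponent negative.
  obtain ⟨ε, hε, hεc, hε1⟩ : ∃ ε : ℝ, 0 < ε ∧ ε * s.num j ≤ 1 ∧
      ε * (m2 + (s.num j : ℝ) ^ 2) < w - v := by
    have hd : 0 < w - v := sub_pos.2 hlt
    refine ⟨min (1 / (1 + s.num j)) ((w - v) / (2 * (1 + m2 + (s.num j : ℝ) ^ 2))), ?_, ?_, ?_⟩
    · positivity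
    · calc _ ≤ 1 / (1 + (s.num j : ℝ)) * s.num j := by gcongr; exact min_le_left _ _
        _ ≤ 1 := by
          rw [div_mul_eq_mul_div, div_le_one (by positivity)]
          linarith
    · calc _ ≤ (w - v) / (2 * (1 + m2 + (s.num j : ℝ) ^ 2)) * (m2 + (s.num j : ℝ) ^ 2) := by
            gcongr; exact min_le_right _ _
        _ < w - v := by
          rw [div_mul_eq_mul_div, div_lt_iff₀ (by positivity)]
          nlinarith [sq_nonneg (s.num j : ℝ)]
  set Φ1 := mean (arrivalLaw A μ)
    (fun a => ENNReal.ofReal (Real.exp (-(ε * ((N s * a j s : ℕ) : ℝ))))) with hΦ1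
  set Φ2 := mean p (fun d => ENNReal.ofReal (Real.exp (ε * (if d = s then s.num j else 0 : ℕ))))
    with hΦ2
  have hφ : Φ1 * Φ2 < 1 := by
    have h1 := mean_exp_neg_le (arrivalLaw A μ) (fun a => N s * a j s) hε.le hm1t hm2t
    have h2 := mean_exp_draw_le p s (s.num j) hε.le hεc
    refine (mul_le_mul' h1 h2).trans_lt ?_
    rw [← ENNReal.ofReal_mul (Real.exp_pos _).le, ← Real.exp_add, ENNReal.ofReal_lt_one,
      Real.exp_lt_one_iff, hm1r]
    have : ε * (ε * (m2 + (s.num j : ℝ) ^ 2)) < ε * (w - v) := by gcongr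
    nlinarith
  refine isTransientOn_of_geometric (g := fun α =>
    ENNReal.ofReal (Real.exp (-(ε * (fullWorkload N α j s : ℝ))))) (φ := Φ1 * Φ2)
    (isClosedOn_stateSpace hN hμ hA) hφ
    (fun α => (ENNReal.ofReal_pos.2 (Real.exp_pos _)).ne') (fun _ => ENNReal.ofReal_ne_top) ?_
  intro α hα
  rw [mean_queueChain]
  set G := ENNReal.ofReal (Real.exp (-(ε * (fullWorkload N α j s : ℝ))))
  have hR : Φ1 * Φ2 * G = mean p fun d => mean (arrivalLaw A μ) fun a =>
      (G * ENNReal.ofReal (Real.exp (ε * (if d = s then s.num j else 0 : ℕ)))) *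
        ENNReal.ofReal (Real.exp (-(ε * ((N s * a j s : ℕ) : ℝ)))) := by
    simp only [mean_const_mul, mean_mul_const]
    ring
  rw [hR]
  refine mean_mono fun d => mean_mono_support fun a ha => ?_
  have h := fullWorkload_lower hN
    (nextState_mem_and_dynamics hN hα d (inUse_of_arrival hμ hA ha)).2 j s
  have h' := (Nat.cast_le (α := ℝ)).2 h
  rw [Nat.cast_add, Nat.cast_add] at h'
  rw [← ENNReal.ofReal_mul (Real.exp_pos _).le, ← Real.exp_add,
    ← ENNReal.ofReal_mul (Real.exp_pos _).le, ← Real.exp_add]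
  refine ENNReal.ofReal_le_ofReal (Real.exp_le_exp.2 ?_)
  nlinarith

end Transience

/-! ### Reachability of a common state -/

section Reachability

variable {J K : ℕ} {N : Sched J K → ℕ} {p : PMF (Sched J K)} {μ : Fin J → PMF (Sched J K)}
  {A : Fin J → PMF ℕ} {lam : Fin J → ℝ≥0}

/-- The schedule `s` is drawn and the messages `a` arrive in `n` consecutive slots. -/
def runSlots (N : Sched J K → ℕ) (s : Sched J K) (a : Fin J → Sched J K → ℕ) (n : ℕ)
    (α : QState J K) : QState J K :=
  (fun β => nextState N β s a)^[n] α

lemma runSlots_succ (s : Sched J K) (a : Fin J → Sched J K → ℕ) (n : ℕ) (α : QState J K) :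
    runSlots N s a (n + 1) α = nextState N (runSlots N s a n α) s a :=
  Function.iterate_succ_apply' _ _ _

lemma runSlots_add (s : Sched J K) (a : Fin J → Sched J K → ℕ) (m n : ℕ) (α : QState J K) :
    runSlots N s a (m + n) α = runSlots N s a n (runSlots N s a m α) := by
  rw [runSlots, Nat.add_comm, Function.iterate_add_apply]
  rfl

lemma runSlots_mem (hN : PosLength N) {α : QState J K} (hα : α ∈ stateSpace N p μ) (s : Sched J K)
    {a : Fin J → Sched J K → ℕ} (ha : ∀ j t, a j t ≠ 0 → InUse p μ j t) (n : ℕ) :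
    runSlots N s a n α ∈ stateSpace N p μ := by
  induction n with
  | zero => exact hα
  | succ n ih =>
    rw [runSlots_succ]
    exact (nextState_mem_and_dynamics hN ih s ha).1

lemma runSlots_reach (α : QState J K) {s : Sched J K} (hs : p s ≠ 0)
    {a : Fin J → Sched J K → ℕ} (ha : arrivalLaw A μ a ≠ 0) (n : ℕ) :
    Relation.ReflTransGen (CanStep (queueChain N p μ A)) α (runSlots N s a n α) := by
  induction n with
  | zero => exact .refl
  | succ n ih =>
    refine ih.tail (canStep_iff.2 ⟨s, a, hs, ha, ?_⟩)
    rw [runSlots_succ]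

lemma runSlots_other (hN : PosLength N) {α : QState J K} (hα : α ∈ stateSpace N p μ)
    (s : Sched J K) {a : Fin J → Sched J K → ℕ} (ha : ∀ j t, a j t ≠ 0 → InUse p μ j t) (n : ℕ)
    {t : Sched J K} (ht : t ≠ s) :
    residualOf N (runSlots N s a n α) t = residualOf N α t ∧
      ∀ j, fresh N (runSlots N s a n α) j t = fresh N α j t + n * a j t := by
  induction n with
  | zero => simp [runSlots]
  | succ n ih =>
    rw [runSlots_succ]
    have h := (nextState_mem_and_dynamics hN (runSlots_mem hN hα s ha n) s ha).2
    refine ⟨(h.residual_other t ht).trans ih.1, fun j => ?_⟩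
    rw [h.fresh_other t ht, ih.2]
    ring

lemma runSlots_busy (hN : PosLength N) {α : QState J K} (hα : α ∈ stateSpace N p μ)
    (s : Sched J K) {a : Fin J → Sched J K → ℕ} (ha : ∀ j t, a j t ≠ 0 → InUse p μ j t) (n : ℕ)
    (hn : n ≤ residualOf N α s) :
    residualOf N (runSlots N s a n α) s = residualOf N α s - n ∧
      ∀ j, fresh N (runSlots N s a n α) j s = fresh N α j s + n * a j s := by
  induction n with
  | zero => simp [runSlots]
  | succ n ih =>
    have ih := ih (by omega)
    rw [runSlots_succ]
    have h := (nextState_mem_and_dynamics hN (runSlots_mem hN hα s ha n) s ha).2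
    have hb : residualOf N (runSlots N s a n α) s ≠ 0 := by omega
    refine ⟨?_, fun j => ?_⟩
    · rw [h.residual_busy hb]; omega
    · rw [h.fresh_busy hb, ih.2]; ring

/-- There is no ongoing transmission of `s`, and there are messages of `s` if the arrival vector `a`
contains any. -/
def Ready (N : Sched J K → ℕ) (s : Sched J K) (a : Fin J → Sched J K → ℕ) (α : QState J K) :
    Prop :=
  residualOf N α s = 0 ∧ ((∃ j, a j s ≠ 0) → ∃ j, fresh N α j s ≠ 0)

/-- From a ready state a block of N(s) slots is exactly one transmission of s, or stays idle when
there are neither messages of s nor arrivals. Without readiness, a first slot without messages but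
with arrivals would break the period. -/
lemma runSlots_block (hN : PosLength N) {α : QState J K} (hα : α ∈ stateSpace N p μ)
    (s : Sched J K) {a : Fin J → Sched J K → ℕ} (ha : ∀ j t, a j t ≠ 0 → InUse p μ j t)
    (hr : Ready N s a α) :
    Ready N s a (runSlots N s a (N s) α) ∧ ∀ j, fresh N (runSlots N s a (N s) α) j s =
      fresh N α j s - min (s.num j) (fresh N α j s) + N s * a j s := by
  have hd := fun β (hβ : β ∈ stateSpace N p μ) => (nextState_mem_and_dynamics hN hβ s ha).2
  have key : residualOf N (runSlots N s a (N s) α) s = 0 ∧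
      ∀ j, fresh N (runSlots N s a (N s) α) j s =
        fresh N α j s - min (s.num j) (fresh N α j s) + N s * a j s := by
    by_cases hf : ∃ j, fresh N α j s ≠ 0
    · obtain ⟨i, hi⟩ := hf
      have hsi := (inUse_of_fresh hα hi).1
      obtain ⟨n, hn⟩ := Nat.exists_eq_add_of_le (hN s i hsi)
      have h1 := hd α hα
      have hne : ¬ ∀ j, min (s.num j) (fresh N α j s) = 0 := fun h => by
        have := h i; omega
      have hres : residualOf N (nextState N α s a) s = n := by
        rw [h1.residual_idle hr.1, if_neg hne]; omega
      have h2 := runSlots_busy hN (runSlots_mem hN hα s ha 1) s ha n hres.ge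
      rw [← runSlots_add, ← hn] at h2
      change _ = residualOf N (nextState N α s a) s - n ∧
        ∀ j, _ = fresh N (nextState N α s a) j s + _ at h2
      refine ⟨by rw [h2.1, hres, Nat.sub_self], fun j => ?_⟩
      rw [h2.2, h1.fresh_idle hr.1, hn]
      ring
    · have ha0 : ∀ j, a j s = 0 := by
        by_contra! h
        exact hf (hr.2 h)
      push Not at hf
      have : ∀ n, residualOf N (runSlots N s a n α) s = 0 ∧
          ∀ j, fresh N (runSlots N s a n α) j s = 0 := by
        intro n
        induction n with
        | zero => exact ⟨hr.1, hf⟩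
        | succ n ih =>
          rw [runSlots_succ]
          have h := hd _ (runSlots_mem hN hα s ha n)
          refine ⟨?_, fun j => ?_⟩
          · rw [h.residual_idle ih.1, if_pos]
            intro j
            rw [ih.2, Nat.min_zero]
          · rw [h.fresh_idle ih.1, ih.2, ha0]; simp
      refine ⟨(this _).1, fun j => ?_⟩
      rw [(this _).2, hf, ha0]
      simp
  refine ⟨⟨key.1, fun ⟨j, hj⟩ => ⟨j, ?_⟩⟩, key.2⟩
  have h1 := hN s j (ha j s hj).1
  have : N s * a j s ≠ 0 := mul_ne_zero (by omega) hj
  rw [key.2]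
  omega

/-- Each block maps a fresh number β to max(β - s_j, 0) + N(s) a_{js}. Where N(s) a_{js} < s_j, this
decreases strictly while β > s_j and gives the fixed point N(s) a_{js} once β ≤ s_j. Arrivals may be
unavoidable, so the target need not be an empty queue. -/
lemma runSlots_drain (hN : PosLength N) (s : Sched J K) {a : Fin J → Sched J K → ℕ}
    (ha : ∀ j t, a j t ≠ 0 → InUse p μ j t) (hsmall : ∀ j, a j s ≠ 0 → N s * a j s < s.num j)
    (k : ℕ) : ∀ α ∈ stateSpace N p μ, Ready N s a α →
      (∀ j, fresh N α j s = N s * a j s ∨ fresh N α j s < k) →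
      Ready N s a (runSlots N s a (k * N s) α) ∧
        ∀ j, fresh N (runSlots N s a (k * N s) α) j s = N s * a j s := by
  induction k with
  | zero =>
    intro α hα hr hk
    rw [Nat.zero_mul]
    exact ⟨hr, fun j => (hk j).resolve_right (Nat.not_lt_zero _)⟩
  | succ k ih =>
    intro α hα hr hk
    rw [Nat.succ_mul, Nat.add_comm, runSlots_add]
    obtain ⟨hr', hf'⟩ := runSlots_block hN hα s ha hr
    refine ih _ (runSlots_mem hN hα s ha _) hr' fun j => ?_
    rw [hf']
    by_cases hf0 : fresh N α j s = 0
    · left; rw [hf0]; simp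
    have hs := (inUse_of_fresh hα hf0).1
    have hlt : N s * a j s < s.num j := by
      by_cases haj : a j s = 0
      · simpa [haj] using hs
      · exact hsmall j haj
    rcases le_total (fresh N α j s) (s.num j) with h | h
    · left; rw [min_eq_right h]; simp
    · have h2 := hk j
      rw [min_eq_left h]
      by_cases heq : fresh N α j s = s.num j
      · left; rw [heq]; simp
      · right; omega

variable {a : Sched J K → Fin J → Sched J K → ℕ}

lemma Ready.runSlots_other (hN : PosLength N) {α : QState J K} (hα : α ∈ stateSpace N p μ)
    {s t : Sched J K} (ha : ∀ j t, a s j t ≠ 0 → InUse p μ j t) (n : ℕ) (ht : t ≠ s)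
    (h : Ready N t (a t) α) : Ready N t (a t) (runSlots N s (a s) n α) := by
  have h' := _root_.runSlots_other hN hα s ha n ht
  refine ⟨h'.1.trans h.1, fun hex => ?_⟩
  obtain ⟨j, hj⟩ := h.2 hex
  exact ⟨j, by rw [h'.2]; omega⟩

/-- Drawing s completes its transmission; if it then has no messages although a(s) brings some, one
more slot supplies them. Drawing s does not destroy the readiness of other schedules, so they can be
treated in turn. -/
lemma exists_reach_ready (hN : PosLength N) (hμ : IsSplitting μ) (hA : HasRates A lam)
    (ha : ∀ s, p s ≠ 0 → arrivalLaw A μ (a s) ≠ 0) {α : QState J K} (hα : α ∈ stateSpace N p μ)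
    (F : Finset (Sched J K)) (hF : ∀ s ∈ F, p s ≠ 0) :
    ∃ β, Relation.ReflTransGen (CanStep (queueChain N p μ A)) α β ∧
      ∀ s ∈ F, Ready N s (a s) β := by
  induction F using Finset.induction_on with
  | empty => exact ⟨α, .refl, by simp⟩
  | insert s F hs ih =>
    obtain ⟨β, hβ, hready⟩ := ih fun t ht => hF t (Finset.mem_insert_of_mem ht)
    have hps := hF s (Finset.mem_insert_self _ _)
    have hin : ∀ j t, a s j t ≠ 0 → InUse p μ j t := inUse_of_arrival hμ hA (ha s hps)
    have hβS := (isClosedOn_stateSpace hN hμ hA).reach hα hβ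
    suffices h : ∃ n, Ready N s (a s) (runSlots N s (a s) n β) by
      obtain ⟨n, hn⟩ := h
      refine ⟨runSlots N s (a s) n β, hβ.trans (runSlots_reach β hps (ha s hps) n), ?_⟩
      intro t ht
      rcases Finset.mem_insert.1 ht with rfl | ht
      · exact hn
      · exact (hready t ht).runSlots_other hN hβS hin n (ne_of_mem_of_not_mem ht hs)
    have h1 := runSlots_busy hN hβS s hin _ le_rfl
    rw [Nat.sub_self] at h1
    set γ := runSlots N s (a s) (residualOf N β s) β with hγ
    by_cases hr : Ready N s (a s) γ
    · exact ⟨_, hr⟩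
    · refine ⟨residualOf N β s + 1, ?_⟩
      rw [runSlots_succ, ← hγ]
      have h2 := (nextState_mem_and_dynamics hN (runSlots_mem hN hβS s hin (residualOf N β s)) s hin).2
      rw [← hγ] at h2
      have hf : (∃ j, a s j s ≠ 0) ∧ ∀ j, fresh N γ j s = 0 := by
        by_contra hc
        refine hr ⟨h1.1, fun hex => ?_⟩
        by_contra! hall
        exact hc ⟨hex, hall⟩
      refine ⟨?_, fun ⟨j, hj⟩ => ⟨j, ?_⟩⟩
      · rw [h2.residual_idle h1.1, if_pos]
        intro j
        rw [hf.2 j, Nat.min_zero]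
      · rw [h2.fresh_idle h1.1, hf.2 j]
        simpa using hj

/-- Drain one schedule after another, for the same number of slots from every starting state. The
queues of the other schedules then receive identical arrivals, so those that already agree keep
agreeing. -/
lemma exists_merge (hN : PosLength N) (hμ : IsSplitting μ) (hA : HasRates A lam)
    (ha : ∀ s, p s ≠ 0 → arrivalLaw A μ (a s) ≠ 0)
    (hsmall : ∀ s, p s ≠ 0 → ∀ j, a s j s ≠ 0 → N s * a s j s < s.num j)
    (Z : Finset (QState J K)) (hZ : ∀ α ∈ Z, α ∈ stateSpace N p μ)
    (hready : ∀ α ∈ Z, ∀ s, p s ≠ 0 → Ready N s (a s) α)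
    (F : Finset (Sched J K)) (hF : ∀ s ∈ F, p s ≠ 0) :
    ∃ Φ : QState J K → QState J K, (∀ α ∈ Z,
      Relation.ReflTransGen (CanStep (queueChain N p μ A)) α (Φ α) ∧
        ∀ s, p s ≠ 0 → Ready N s (a s) (Φ α)) ∧
      ∀ α ∈ Z, ∀ β ∈ Z, ∀ s ∈ F, ∀ j, fresh N (Φ α) j s = fresh N (Φ β) j s := by
  induction F using Finset.induction_on with
  | empty => exact ⟨id, fun α hα => ⟨.refl, hready α hα⟩, by simp⟩
  | insert s F hs ih =>
    obtain ⟨Φ, hΦ, hmerge⟩ := ih fun t ht => hF t (Finset.mem_insert_of_mem ht)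
    have hps := hF s (Finset.mem_insert_self _ _)
    have hin : ∀ j t, a s j t ≠ 0 → InUse p μ j t := inUse_of_arrival hμ hA (ha s hps)
    have hmem : ∀ α ∈ Z, Φ α ∈ stateSpace N p μ := fun α hα =>
      (isClosedOn_stateSpace hN hμ hA).reach (hZ α hα) (hΦ α hα).1
    set k := (Z.sup fun α => Finset.univ.sup fun j => fresh N (Φ α) j s) + 1 with hk
    have hlt : ∀ α ∈ Z, ∀ j, fresh N (Φ α) j s < k := fun α hα j => Nat.lt_succ_of_le
      ((Finset.le_sup (f := fun j => fresh N (Φ α) j s) (Finset.mem_univ j)).trans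
        (Finset.le_sup (f := fun α => Finset.univ.sup fun j => fresh N (Φ α) j s) hα))
    have hdrain := fun α hα => runSlots_drain hN s hin (hsmall s hps) k (Φ α) (hmem α hα)
      ((hΦ α hα).2 s hps) fun j => Or.inr (hlt α hα j)
    refine ⟨fun α => runSlots N s (a s) (k * N s) (Φ α), fun α hα => ⟨?_, fun t ht => ?_⟩, ?_⟩
    · exact (hΦ α hα).1.trans (runSlots_reach _ hps (ha s hps) _)
    · by_cases hts : t = s
      · subst hts
        exact (hdrain α hα).1
      · exact ((hΦ α hα).2 t ht).runSlots_other hN (hmem α hα) hin _ hts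
    · intro α hα β hβ t ht j
      by_cases hts : t = s
      · subst hts
        rw [(hdrain α hα).2, (hdrain β hβ).2]
      · rw [(runSlots_other hN (hmem α hα) s hin _ hts).2,
          (runSlots_other hN (hmem β hβ) s hin _ hts).2,
          hmerge α hα β hβ t (Finset.mem_of_mem_insert_of_ne ht hts)]

lemma nil_mem_stateSpace (N : Sched J K → ℕ) (p : PMF (Sched J K))
    (μ : Fin J → PMF (Sched J K)) : (fun _ _ => []) ∈ stateSpace N p μ :=
  ⟨fun _ _ h => absurd rfl h, fun _ _ _ hx => absurd hx List.not_mem_nil,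
    fun _ => ⟨0, fun _ => ⟨0, Nat.zero_le _, 0, fun h => absurd rfl h, rfl⟩⟩⟩

/-- Any finite set of states leads to a common state. -/
theorem exists_common_reach (hN : PosLength N) (hμ : IsSplitting μ) (hA : HasRates A lam)
    (hstab : ∀ j s, InUse p μ j s →
      (N s : ℝ) * ((lam j : ℝ) * (μ j s).toReal) < (p s).toReal * (s.num j : ℝ))
    {C : Set (QState J K)} (hC : C ⊆ stateSpace N p μ) (hfin : C.Finite) :
    ∃ y ∈ stateSpace N p μ, ∀ x ∈ C, Relation.TransGen (CanStep (queueChain N p μ A)) x y := by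
  classical
  rcases C.eq_empty_or_nonempty with rfl | ⟨x0, hx0⟩
  · exact ⟨_, nil_mem_stateSpace N p μ, by simp⟩
  -- Possible because the mean new work is less than p(s) s_j ≤ s_j.
  have hsmall : ∀ s, ∃ a, arrivalLaw A μ a ≠ 0 ∧ ∀ j, μ j s ≠ 0 → N s * a j s < s.num j := by
    intro s
    refine exists_small_arrivals hA s (N s) (fun j => s.num j) fun j hj => ?_
    refine (hstab j s ⟨hμ j s hj, Or.inr hj⟩).trans_le ?_
    have : (p s).toReal ≤ 1 := ENNReal.toReal_mono ENNReal.one_ne_top (p.coe_le_one s)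
    exact mul_le_of_le_one_left (Nat.cast_nonneg _) this
  choose a ha hsmall using hsmall
  have hclosed := isClosedOn_stateSpace (p := p) hN hμ hA
  set U : Finset (Sched J K) := Finset.univ.filter fun s => p s ≠ 0 with hU
  have hUp : ∀ s ∈ U, p s ≠ 0 := fun s hs => (Finset.mem_filter.1 hs).2
  have hprep : ∀ x ∈ C, ∃ z, Relation.TransGen (CanStep (queueChain N p μ A)) x z ∧
      ∀ s, p s ≠ 0 → Ready N s (a s) z := by
    intro x hx
    obtain ⟨x1, hx1⟩ := (queueChain N p μ A x).support_nonempty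
    have hstep : CanStep (queueChain N p μ A) x x1 := hx1
    obtain ⟨z, hz, hr⟩ := exists_reach_ready hN hμ hA (fun s _ => ha s) (hclosed x (hC hx) x1 hx1)
      U hUp
    exact ⟨z, Relation.TransGen.head' hstep hz, fun s hs => hr s (by simp [hU, hs])⟩
  choose! g hg hgr using hprep
  have hgS : ∀ x ∈ C, g x ∈ stateSpace N p μ := fun x hx =>
    hclosed.reach (hC hx) (hg x hx).to_reflTransGen
  obtain ⟨Φ, hΦ, hmerge⟩ := exists_merge hN hμ hA (fun s _ => ha s)
    (fun s _ j hj => hsmall s j (splitting_ne_zero_of_arrival hA (ha s) hj))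
    (hfin.toFinset.image g) (by simpa using hgS) (by simpa using hgr) U hUp
  have hmem : ∀ x ∈ C, g x ∈ hfin.toFinset.image g := fun x hx =>
    Finset.mem_image_of_mem g (hfin.mem_toFinset.2 hx)
  have hΦS : ∀ x ∈ C, Φ (g x) ∈ stateSpace N p μ := fun x hx =>
    hclosed.reach (hgS x hx) (hΦ _ (hmem x hx)).1
  refine ⟨Φ (g x0), hΦS x0 hx0, fun x hx => ?_⟩
  have heq : Φ (g x) = Φ (g x0) := by
    funext j s
    -- A schedule that is never drawn has no subclass in use, by the load condition, so its queues
    -- are empty; the others are idle and determined by their fresh numbers.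
    by_cases hs : p s = 0
    · have hnot : ¬ InUse p μ j s := fun hu => by
        have h := hstab j s hu
        rw [hs, ENNReal.toReal_zero, zero_mul] at h
        have h0 : (0 : ℝ) ≤ (N s : ℝ) * ((lam j : ℝ) * (μ j s).toReal) := by positivity
        linarith
      rw [not_not.1 fun h => hnot ((hΦS x hx).1 j s h),
        not_not.1 fun h => hnot ((hΦS x0 hx0).1 j s h)]
    · rw [eq_replicate_of_residual (hΦS x hx) ((hΦ _ (hmem x hx)).2 s hs).1,
        eq_replicate_of_residual (hΦS x0 hx0) ((hΦ _ (hmem x0 hx0)).2 s hs).1,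
        hmerge _ (hmem x hx) _ (hmem x0 hx0) s (by simp [hU, hs])]
  exact heq ▸ (hg x hx).trans_left (hΦ _ (hmem x hx)).1

/-- Regularity and stability if the mean service exceeds the mean arriving work in all queues in
use. -/
theorem regular_and_stable (hN : PosLength N) (hμ : IsSplitting μ) (hA : HasRates A lam)
    (hstab : ∀ j s, InUse p μ j s →
      (N s : ℝ) * ((lam j : ℝ) * (μ j s).toReal) < (p s).toReal * (s.num j : ℝ)) :
    IsCRegularOn (queueChain N p μ A) (stateSpace N p μ) (queueCost N) ∧
      IsStableOn (queueChain N p μ A) (stateSpace N p μ) numMessages := by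
  have h := isCRegularOn_queue hN hμ hA hstab fun C hC hfin =>
    exists_common_reach hN hμ hA hstab hC hfin
  refine ⟨h, h.isStableOn (isClosedOn_stateSpace hN hμ hA) (fun α => ?_) fun α hα =>
    numMessages_le hN hα⟩
  rw [queueCost]
  exact_mod_cast Nat.le_add_right _ _

end Reachability

/-! ### The stability region of a policy -/

section Region

variable {J K : ℕ} {N : Sched J K → ℕ} {p : PMF (Sched J K)} {μ : Fin J → PMF (Sched J K)}
  {A : Fin J → PMF ℕ} {lam : Fin J → ℝ≥0}

/-- There is a batch-size law with a given mean, finite second moment, and an atom at zero. -/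
lemma exists_batch_law (l : ℝ≥0) : ∃ q : PMF ℕ, mean q (fun k => (k : ℝ≥0∞)) = l ∧
    mean q (fun k => (k : ℝ≥0∞) ^ 2) < ∞ ∧ q 0 ≠ 0 := by
  -- A two-point law: the value m > l with probability l / m < 1, and 0 otherwise.
  set m : ℕ := ⌊l⌋₊ + 1 with hm
  have hlt : l < m := by rw [hm]; exact_mod_cast Nat.lt_floor_add_one l
  have hm0 : (m : ℝ≥0) ≠ 0 := by positivity
  set t : ℝ≥0 := l / m with ht
  have ht1 : t < 1 := (div_lt_one (by positivity)).2 hlt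
  set B : PMF Bool := PMF.ofFintype (fun c => cond c (t : ℝ≥0∞) ((1 - t : ℝ≥0) : ℝ≥0∞)) (by
    simp only [Fintype.sum_bool, cond_true, cond_false]
    exact_mod_cast add_tsub_cancel_of_le ht1.le) with hB
  have hmean : ∀ f : ℕ → ℝ≥0∞, f 0 = 0 →
      mean (B.map fun c => if c then m else 0) f = t * f m := by
    intro f hf
    rw [mean_map, mean_eq_sum]
    simp [hB, hf]
  refine ⟨B.map fun c => if c then m else 0, ?_, ?_, ?_⟩
  · rw [hmean _ (by simp)]
    have : t * (m : ℝ≥0) = l := div_mul_cancel₀ _ hm0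
    exact_mod_cast this
  · rw [hmean _ (by simp)]
    exact ENNReal.mul_lt_top (by simp) (by simp)
  · rw [← PMF.mem_support_iff, PMF.mem_support_map_iff]
    refine ⟨false, ?_, by simp⟩
    rw [PMF.mem_support_iff, hB, PMF.ofFintype_apply]
    simpa [tsub_eq_zero_iff_le] using ht1

lemma arrivalLaw_zero_ne_zero (hA : ∀ j, A j 0 ≠ 0) (μ : Fin J → PMF (Sched J K)) :
    arrivalLaw A μ (fun _ _ => 0) ≠ 0 := by
  refine indepLaw_ne_zero _ _ fun j => ?_
  rw [← PMF.mem_support_iff, PMF.mem_support_bind_iff]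
  refine ⟨0, hA j, ?_⟩
  rw [labelCounts, PMF.mem_support_pure_iff]

lemma invariant_reach {X : Type*} {P : X → PMF X} {π : PMF X} (hπ : π.bind P = π) {x y : X}
    (hx : π x ≠ 0) (h : Relation.ReflTransGen (CanStep P) x y) : π y ≠ 0 := by
  induction h with
  | refl => exact hx
  | tail _ h ih =>
    rw [← hπ, ← PMF.mem_support_iff, PMF.mem_support_bind_iff]
    exact ⟨_, ih, h⟩

lemma le_fresh_nextState {α α' : QState J K} {d : Sched J K} {a : Fin J → Sched J K → ℕ}
    (h : SlotDynamics N α α' d a) (j : Fin J) (t : Sched J K) : a j t ≤ fresh N α' j t := by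
  by_cases hd : t = d
  · subst hd
    by_cases hr : residualOf N α t = 0
    · rw [h.fresh_idle hr]; omega
    · rw [h.fresh_busy hr]; omega
  · rw [h.fresh_other t hd]; omega

lemma fullWorkload_le_numMessages {α : QState J K} (hα : α ∈ stateSpace N p μ) (j : Fin J)
    (s : Sched J K) : fullWorkload N α j s ≤ N s * numMessages α + s.num j * N s := by
  have h1 : fresh N α j s ≤ numMessages α :=
    (fresh_le_length N α j s).trans ((Finset.single_le_sum (f := fun s => (α j s).length)
      (fun _ _ => Nat.zero_le _) (Finset.mem_univ s)).trans (Finset.single_le_sum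
        (f := fun j => ∑ s, (α j s).length) (fun _ _ => Nat.zero_le _) (Finset.mem_univ j)))
  have h2 := residual_lt hα s
  unfold fullWorkload
  gcongr

/-- If the mean arriving work is not below the mean service and there may be slots without
arrivals, then there is no invariant law with finite mean number of messages. -/
lemma not_exists_invariant (hN : PosLength N) (hμ : IsSplitting μ) (hA : HasRates A lam)
    (hA0 : ∀ j, A j 0 ≠ 0) {j : Fin J} {s : Sched J K} (hs : 0 < s.num j) (hp : p s ≠ 0)
    (hge : p s * s.num j ≤ N s * (lam j * μ j s)) {π : PMF (QState J K)}
    (hπS : π.support ⊆ stateSpace N p μ) (hπ : π.bind (queueChain N p μ A) = π) :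
    ¬ ∑' α, π α * (numMessages α : ℝ≥0∞) < ∞ := by
  intro hfin
  have hclosed := isClosedOn_stateSpace (p := p) hN hμ hA
  have hlaw := arrivalLaw_zero_ne_zero hA0 μ
  have hz : ∀ (i : Fin J) (t : Sched J K), (0 : ℕ) ≠ 0 → InUse p μ i t := by simp
  obtain ⟨x, hx⟩ := π.support_nonempty
  obtain ⟨y, hxy, hy⟩ := exists_reach_ready hN hμ hA (a := fun _ _ _ => 0) (fun _ _ => hlaw)
    (hπS hx) {s} (by simpa using hp)
  have hyS := hclosed.reach (hπS hx) hxy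
  -- Without arrivals the draining fixed point is 0, so the empty queue is reached and the
  -- stationary law charges a state z with H(z) = 0.
  have hdrain := runSlots_drain hN s (a := fun _ _ => 0) hz (by simp)
    ((Finset.univ.sup fun i => fresh N y i s) + 1) y hyS (hy s (by simp)) fun i =>
    Or.inr (Nat.lt_succ_of_le (Finset.le_sup (f := fun i => fresh N y i s) (Finset.mem_univ i)))
  set z := runSlots N s (fun _ _ => 0) (((Finset.univ.sup fun i => fresh N y i s) + 1) * N s) y
  have hyz : Relation.ReflTransGen (CanStep (queueChain N p μ A)) y z :=
    runSlots_reach y hp hlaw _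
  have hzπ : π z ≠ 0 := invariant_reach hπ hx (hxy.trans hyz)
  have hzS : z ∈ stateSpace N p μ := hclosed.reach hyS hyz
  have hHz : fullWorkload N z j s = 0 := by
    rw [fullWorkload, hdrain.1.1, hdrain.2]; simp
  set w : ℝ≥0∞ := N s * (lam j * μ j s) with hw
  set v : ℝ≥0∞ := p s * s.num j with hv
  have hwt : w ≠ ∞ :=
    ENNReal.mul_ne_top (by simp) (ENNReal.mul_ne_top (by simp) ((μ j).apply_ne_top s))
  have hv0 : v ≠ 0 := mul_ne_zero hp (by exact_mod_cast hs.ne')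
  set H : QState J K → ℝ≥0∞ := fun α => (fullWorkload N α j s : ℝ≥0∞) with hH
  have hmH : mean π H ≠ ∞ := by
    have h1 : mean π H ≤ mean π fun α => (N s : ℝ≥0∞) * numMessages α + (s.num j * N s : ℕ) := by
      refine mean_mono_support fun α hα => ?_
      have := fullWorkload_le_numMessages (hπS hα) j s
      simp only [hH]
      exact_mod_cast this
    refine ne_top_of_le_ne_top ?_ h1
    rw [mean_add, mean_const_mul, mean_const]
    exact ENNReal.add_ne_top.2 ⟨ENNReal.mul_ne_top (by simp) hfin.ne,
      ENNReal.natCast_ne_top _⟩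
  classical
  -- In z there is no work to serve, so the potential service v is wasted. Integrated against π,
  -- where the finite mean of H cancels, this gives w + π(z) v ≤ v, contrary to w ≥ v.
  have hstep : ∀ α ∈ stateSpace N p μ, H α + w + (if α = z then v else 0) ≤
      mean (queueChain N p μ A α) H + v := by
    intro α hα
    rw [mean_queueChain]
    have hdyn := fun d a ha =>
      (nextState_mem_and_dynamics hN hα d (inUse_of_arrival (a := a) hμ hA ha)).2
    have hwm : w = mean p fun _ => mean (arrivalLaw A μ) fun a => (N s : ℝ≥0∞) * a j s := by
      rw [mean_const, mean_const_mul, mean_arrivals hA]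
    split_ifs with hαz
    · have hH0 : H α = 0 := by simp only [hH, hαz, hHz, Nat.cast_zero]
      rw [hH0, zero_add, hwm]
      gcongr
      refine mean_mono fun d => mean_mono_support fun a ha => ?_
      have h := le_fresh_nextState (hdyn d a ha) j s
      have h' : N s * a j s ≤ fullWorkload N (nextState N α d a) j s :=
        (Nat.mul_le_mul_left _ h).trans (Nat.le_add_right _ _)
      simp only [hH]
      exact_mod_cast h'
    · rw [add_zero]
      have hL : H α + w = mean p fun _ => mean (arrivalLaw A μ) fun a =>
          H α + (N s : ℝ≥0∞) * a j s := by
        simp only [mean_add, mean_const]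
        rw [hwm, mean_const]
      have hvm : v = mean p fun d => if d = s then (s.num j : ℝ≥0∞) else 0 := by
        rw [mean_draw]
      have hR : (mean p fun d => mean (arrivalLaw A μ) fun a => H (nextState N α d a)) + v =
          mean p fun d => mean (arrivalLaw A μ) fun a =>
            H (nextState N α d a) + (if d = s then (s.num j : ℝ≥0∞) else 0) := by
        rw [hvm, ← mean_add]
        simp only [mean_add, mean_const]
      rw [hL, hR]
      refine mean_mono fun d => mean_mono_support fun a ha => ?_
      have h := fullWorkload_lower hN (hdyn d a ha) j s
      simp only [hH]
      exact_mod_cast h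
  have htotal : mean π H + w + π z * v ≤ mean π H + v := by
    have h1 : mean π (fun α => H α + w + (if α = z then v else 0)) ≤
        mean π (fun α => mean (queueChain N p μ A α) H + v) :=
      mean_mono_support fun α hα => hstep α (hπS hα)
    have h2 : mean π (fun α => if α = z then v else 0) = π z * v := by
      rw [mean, tsum_eq_single z]
      · simp
      · intro α hα; simp [hα]
    simp only [mean_add, mean_const, h2] at h1
    rwa [← mean_bind, hπ] at h1
  rw [add_assoc, ENNReal.add_le_add_iff_left hmH] at htotal
  have h3 : w + π z * v ≤ w + 0 := by
    rw [add_zero]; exact htotal.trans hge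
  rw [ENNReal.add_le_add_iff_left hwt] at h3
  exact (mul_ne_zero hzπ hv0) (le_antisymm h3 zero_le)

lemma rate_nonneg (N : Sched J K → ℕ) (s : Sched J K) (j : Fin J) : 0 ≤ rate N s j := by
  unfold rate; positivity

lemma meanRate_nonneg (N : Sched J K → ℕ) (p : PMF (Sched J K)) (j : Fin J) :
    0 ≤ meanRate N p j :=
  Finset.sum_nonneg fun s _ => mul_nonneg ENNReal.toReal_nonneg (rate_nonneg N s j)

lemma length_mul_rate (hN : PosLength N) (s : Sched J K) (j : Fin J) :
    (N s : ℝ) * rate N s j = s.num j := by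
  unfold rate
  rcases Nat.eq_zero_or_pos (s.num j) with h | h
  · simp [h]
  · have := hN s j h
    field_simp

lemma IsPolicySplitting.isSplitting (h : IsPolicySplitting N p μ) : IsSplitting μ := by
  intro j s hjs
  by_contra h0
  have h1 := h j s
  have hnum : s.num j = 0 := by omega
  rw [rate, hnum] at h1
  simp only [Nat.cast_zero, zero_div, mul_zero] at h1
  rcases (ENNReal.toReal_eq_zero_iff _).1 h1 with h2 | h2
  · exact hjs h2
  · exact (μ j).apply_ne_top s h2

/-- The ratio of mean new work to mean service is the same for every schedule of class j, so one
inequality per class decides all load conditions. -/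
lemma IsPolicySplitting.work_eq (h : IsPolicySplitting N p μ) (hN : PosLength N) (l : ℝ)
    (j : Fin J) (s : Sched J K) : (N s : ℝ) * (l * (μ j s).toReal) =
      l / meanRate N p j * ((p s).toReal * s.num j) := by
  rw [h j s, ← length_mul_rate hN s j]
  ring

lemma sum_toReal_eq_one {α : Type*} [Fintype α] (q : PMF α) : ∑ x, (q x).toReal = 1 := by
  rw [← ENNReal.toReal_sum fun x _ => q.apply_ne_top x, ← tsum_fintype (L := .unconditional _),
    q.tsum_coe, ENNReal.toReal_one]

lemma exists_policySplitting (h : ∀ j, 0 < meanRate N p j) :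
    ∃ μ : Fin J → PMF (Sched J K), IsPolicySplitting N p μ := by
  have hnn : ∀ j s, 0 ≤ (p s).toReal * rate N s j / meanRate N p j := fun j s =>
    div_nonneg (mul_nonneg ENNReal.toReal_nonneg (rate_nonneg N s j)) (meanRate_nonneg N p j)
  refine ⟨fun j => PMF.ofFintype
    (fun s => ENNReal.ofReal ((p s).toReal * rate N s j / meanRate N p j)) ?_, fun j s => ?_⟩
  · rw [← ENNReal.ofReal_sum_of_nonneg fun s _ => hnn j s, ← Finset.sum_div]
    change ENNReal.ofReal (meanRate N p j / meanRate N p j) = 1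
    rw [div_self (h j).ne', ENNReal.ofReal_one]
  · rw [PMF.ofFintype_apply, ENNReal.toReal_ofReal (hnn j s)]

theorem stabilityRegion_eq (hN : PosLength N) (p : PMF (Sched J K)) :
    stabilityRegion N p = {lam | ∀ j, (lam j : ℝ) < meanRate N p j} := by
  ext lam
  constructor
  · rintro ⟨μ, hμ, hst⟩ j
    by_contra! hge
    choose A hA1 hA2 hA0 using fun j => exists_batch_law (lam j)
    have hA : HasRates A lam := fun j => ⟨hA1 j, hA2 j⟩
    obtain ⟨-, π, hπS, hπ, hfin⟩ := hst A hA
    obtain ⟨s, hs⟩ := (μ j).support_nonempty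
    have hs0 : μ j s ≠ 0 := hs
    have hsr : (μ j s).toReal ≠ 0 := ENNReal.toReal_ne_zero.2 ⟨hs0, (μ j).apply_ne_top s⟩
    -- A vanishing denominator would give all splitting probabilities the value 0, by the convention
    -- x / 0 = 0.
    have hm : meanRate N p j ≠ 0 := fun h0 => hsr (by rw [hμ j s, h0, div_zero])
    have hmpos : 0 < meanRate N p j := lt_of_le_of_ne (meanRate_nonneg N p j) hm.symm
    have hp : p s ≠ 0 := fun h0 => hsr (by rw [hμ j s, h0]; simp)
    refine not_exists_invariant hN hμ.isSplitting hA hA0 (hμ.isSplitting j s hs0) hp ?_ hπS hπ hfin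
    have hf1 : p s * (s.num j : ℝ≥0∞) ≠ ∞ := ENNReal.mul_ne_top (p.apply_ne_top s) (by simp)
    have hf2 : (N s : ℝ≥0∞) * (lam j * μ j s) ≠ ∞ :=
      ENNReal.mul_ne_top (by simp) (ENNReal.mul_ne_top (by simp) ((μ j).apply_ne_top s))
    rw [← ENNReal.toReal_le_toReal hf1 hf2]
    simp only [ENNReal.toReal_mul, ENNReal.toReal_natCast, ENNReal.coe_toReal]
    rw [hμ.work_eq hN]
    exact le_mul_of_one_le_left (by positivity) ((one_le_div hmpos).2 hge)
  · intro h
    have hpos : ∀ j, 0 < meanRate N p j := fun j => (lam j).coe_nonneg.trans_lt (h j)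
    obtain ⟨μ, hμ⟩ := exists_policySplitting hpos
    refine ⟨μ, hμ, fun A hA => (regular_and_stable hN hμ.isSplitting hA fun j s hu => ?_).2⟩
    rw [hμ.work_eq hN]
    have hp : p s ≠ 0 := by
      rcases hu.2 with hp | hm
      · exact hp
      · intro h0
        have h1 := hμ j s
        rw [h0] at h1
        simp only [ENNReal.toReal_zero, zero_mul, zero_div] at h1
        rcases (ENNReal.toReal_eq_zero_iff _).1 h1 with h2 | h2
        · exact hm h2
        · exact (μ j).apply_ne_top s h2
    have hps : 0 < (p s).toReal := ENNReal.toReal_pos hp (p.apply_ne_top s)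
    have hnum : (0 : ℝ) < s.num j := by exact_mod_cast hu.1
    exact mul_lt_of_lt_one_left (by positivity) ((div_lt_one (hpos j)).2 (h j))

end Region

/-! ### The outer bound -/

section Outer

variable {J K : ℕ} {N : Sched J K → ℕ}

/-- Deleting all messages of some sources does not increase the codeword length. -/
def MonoLength (N : Sched J K → ℕ) : Prop :=
  ∀ s t : Sched J K, (∀ j, t.num j = s.num j ∨ t.num j = 0) → (∃ j, 0 < t.num j) → N t ≤ N s

lemma meanRate_mem_convexHull (N : Sched J K → ℕ) (p : PMF (Sched J K)) :
    meanRate N p ∈ convexHull ℝ (Set.range (rate N)) := by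
  have h := (convex_convexHull ℝ (Set.range (rate N))).sum_mem (t := Finset.univ)
    (w := fun s => (p s).toReal) (z := rate N) (fun s _ => ENNReal.toReal_nonneg)
    (sum_toReal_eq_one p) (fun s _ => subset_convexHull ℝ _ (Set.mem_range_self s))
  convert h using 1
  funext j
  simp [meanRate]

lemma exists_meanRate_of_mem_convexHull {x : Fin J → ℝ}
    (hx : x ∈ convexHull ℝ (Set.range (rate N))) : ∃ p, x = meanRate N p := by
  classical
  set f : (Sched J K → ℝ) →ₗ[ℝ] (Fin J → ℝ) := Fintype.linearCombination ℝ (rate N) with hf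
  have hsub : convexHull ℝ (Set.range (rate N)) ⊆ f '' stdSimplex ℝ (Sched J K) := by
    refine convexHull_min ?_ ((convex_stdSimplex ℝ _).linear_image f)
    rintro _ ⟨s, rfl⟩
    exact ⟨Pi.single s 1, single_mem_stdSimplex ℝ s, by simp [hf]⟩
  obtain ⟨w, hw, rfl⟩ := hsub hx
  refine ⟨PMF.ofFintype (fun s => ENNReal.ofReal (w s)) ?_, ?_⟩
  · rw [← ENNReal.ofReal_sum_of_nonneg fun s _ => hw.1 s, hw.2, ENNReal.ofReal_one]
  · funext j
    simp [hf, Fintype.linearCombination_apply, meanRate, ENNReal.toReal_ofReal (hw.1 _)]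

/-- The part of a schedule that belongs to the sources in `T`. -/
def Sched.restrict (s : Sched J K) (T : Finset (Fin J)) : Sched J K :=
  ⟨fun j => if j ∈ T then s.1 j else 0, (Finset.sum_le_sum fun j _ => by
    beta_reduce
    split_ifs
    · exact le_rfl
    · exact Nat.zero_le _).trans s.2⟩

lemma Sched.num_restrict (s : Sched J K) (T : Finset (Fin J)) (j : Fin J) :
    (s.restrict T).num j = if j ∈ T then s.num j else 0 := by
  unfold Sched.num Sched.restrict
  simp only
  split_ifs <;> rfl

lemma rate_le_rate_restrict (hN : PosLength N) (hmono : MonoLength N) (s : Sched J K)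
    (T : Finset (Fin J)) {j : Fin J} (hj : j ∈ T) : rate N s j ≤ rate N (s.restrict T) j := by
  have hnum : (s.restrict T).num j = s.num j := by rw [Sched.num_restrict, if_pos hj]
  unfold rate
  rw [hnum]
  rcases Nat.eq_zero_or_pos (s.num j) with h | h
  · simp [h]
  · have h1 : 1 ≤ N (s.restrict T) := hN _ j (hnum ▸ h)
    have h2 : N (s.restrict T) ≤ N s := by
      refine hmono s _ (fun i => ?_) ⟨j, hnum ▸ h⟩
      rw [Sched.num_restrict]
      split_ifs <;> simp
    have h3 : (0 : ℝ) < N (s.restrict T) := by exact_mod_cast h1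
    gcongr

/-- The outer bound contains with each vector all smaller non-negative vectors. -/
lemma mem_convexHull_of_le (hN : PosLength N) (hmono : MonoLength N) {x y : Fin J → ℝ}
    (hx : x ∈ convexHull ℝ (Set.range (rate N))) (hy0 : 0 ≤ y) (hyx : y ≤ x) :
    y ∈ convexHull ℝ (Set.range (rate N)) := by
  classical
  by_contra hy
  obtain ⟨f, u, hfu, hfy⟩ := geometric_hahn_banach_closed_point
    (convex_convexHull ℝ (Set.range (rate N))) ((Set.finite_range _).isClosed_convexHull ℝ) hy
  set w : Fin J → ℝ := fun j => f (Pi.single j 1) with hw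
  have hrep : ∀ z, f z = ∑ j, z j * w j := by
    intro z
    conv_lhs => rw [pi_eq_sum_univ' z]
    simp only [map_sum, map_smul, smul_eq_mul, hw]
  -- Keeping only the sources of non-negative weight replaces the separating functional f by its
  -- positive part g: g(r(s)) ≤ f(r(s restricted to T)) < u, as the restricted schedule is no slower
  -- on T and has rate 0 off T. Then f(y) ≤ g(y) ≤ g(x) ≤ u < f(y).
  set T : Finset (Fin J) := Finset.univ.filter fun j => 0 ≤ w j with hT
  set g : (Fin J → ℝ) →ₗ[ℝ] ℝ := ∑ j ∈ T, w j • LinearMap.proj j with hg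
  have hgrep : ∀ z, g z = ∑ j ∈ T, z j * w j := by
    intro z
    simp [hg, mul_comm]
  have hvert : ∀ s, g (rate N s) ≤ u := by
    intro s
    have h1 := hfu _ (subset_convexHull ℝ _ (Set.mem_range_self (s.restrict T)))
    refine le_trans ?_ h1.le
    rw [hgrep, hrep, ← Finset.sum_subset (Finset.subset_univ T)]
    · refine Finset.sum_le_sum fun j hj => ?_
      exact mul_le_mul_of_nonneg_right (rate_le_rate_restrict hN hmono s T hj)
        (Finset.mem_filter.1 hj).2
    · intro j _ hj
      rw [rate, Sched.num_restrict, if_neg hj]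
      simp
  have hgx : g x ≤ u := by
    have hconv : Convex ℝ {z | g z ≤ u} := convex_halfSpace_le g.isLinear u
    exact convexHull_min (by rintro _ ⟨s, rfl⟩; exact hvert s) hconv hx
  have hfg : f y ≤ g y := by
    rw [hrep, hgrep, ← Finset.sum_filter_add_sum_filter_not Finset.univ (fun j => 0 ≤ w j)]
    refine add_le_of_nonpos_right (Finset.sum_nonpos fun j hj => ?_)
    exact mul_nonpos_of_nonneg_of_nonpos (hy0 j) (not_le.1 (Finset.mem_filter.1 hj).2).le
  have hgyx : g y ≤ g x := by
    rw [hgrep, hgrep]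
    exact Finset.sum_le_sum fun j hj =>
      mul_le_mul_of_nonneg_right (hyx j) (Finset.mem_filter.1 hj).2
  linarith

/-- Each region is open in the orthant and lies below a point of the hull. Conversely, an interior λ
can be raised by some ε > 0 in all coordinates within the hull, and a policy with mean rates λ + ε
has λ in its region. -/
theorem iUnion_stabilityRegion (hN : PosLength N) (hmono : MonoLength N) :
    (⋃ p : PMF (Sched J K), stabilityRegion N p) = interior (outerRegion N) := by
  simp only [stabilityRegion_eq hN]
  apply Set.Subset.antisymm
  · refine Set.iUnion_subset fun p => interior_maximal ?_ ?_
    · intro lam h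
      exact mem_convexHull_of_le hN hmono (meanRate_mem_convexHull N p)
        (fun j => (lam j).coe_nonneg) fun j => (h j).le
    · simp only [Set.ofPred_forall]
      refine isOpen_iInter_of_finite fun j => ?_
      exact isOpen_lt (by fun_prop) continuous_const
  · intro lam hlam
    have hcont : Filter.Tendsto (fun (ε : ℝ≥0) (j : Fin J) => lam j + ε)
        (nhdsWithin 0 (Set.Ioi 0)) (nhds lam) := by
      have h : Continuous fun (ε : ℝ≥0) (j : Fin J) => lam j + ε := by fun_prop
      have h0 := h.tendsto 0
      simp only [add_zero] at h0
      exact h0.mono_left nhdsWithin_le_nhds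
    have hev := hcont.eventually (mem_interior_iff_mem_nhds.1 hlam)
    obtain ⟨ε, hε, hpos⟩ := (hev.and self_mem_nhdsWithin).exists
    obtain ⟨p, hp⟩ := exists_meanRate_of_mem_convexHull hε
    refine Set.mem_iUnion.2 ⟨p, fun j => ?_⟩
    rw [← congrFun hp j]
    have : (0 : ℝ) < ε := by exact_mod_cast hpos
    push_cast
    linarith

end Outer

/-! ### Codeword lengths -/

section Lengths

variable {J K : ℕ} {N : Sched J K → ℕ}

/-- The bound sums positive terms over the non-empty sets of active sources. Deactivating sources
removes terms and leaves the remaining ones unchanged. -/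
lemma errorBound_mono {ι : Type} [Fintype ι] [DecidableEq ι] (C : MultiaccessChannel ι) (ρ : ℝ)
    {T T' : Finset ι} (hT : T' ⊆ T) {L L' : ι → ℝ} (hL : ∀ i ∈ T', L' i = L i) (n : ℕ) :
    C.errorBound ρ T' L' n ≤ C.errorBound ρ T L n := by
  unfold MultiaccessChannel.errorBound
  calc _ = ∑ S ∈ T'.powerset.filter (fun S => S.Nonempty),
        Real.exp (-(n : ℝ) * (-ρ * ∑ i ∈ S, L i / (n : ℝ) + C.exponent ρ S)) := by
        refine Finset.sum_congr rfl fun S hS => ?_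
        have hsub := Finset.mem_powerset.1 (Finset.mem_filter.1 hS).1
        rw [Finset.sum_congr rfl fun i hi => by rw [hL i (hsub hi)]]
    _ ≤ _ := Finset.sum_le_sum_of_subset_of_nonneg
        (Finset.filter_subset_filter _ (Finset.powerset_mono.2 hT))
        fun _ _ _ => (Real.exp_pos _).le

lemma IsShortestLength.posLength {bound : Sched J K → ℕ → ℝ} {pe : ℝ}
    (h : IsShortestLength bound pe N) : PosLength N :=
  fun s j hj => (h s ⟨j, hj⟩).1.1

lemma IsShortestLength.monoLength {bound : Sched J K → ℕ → ℝ} {pe : ℝ}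
    (h : IsShortestLength bound pe N)
    (hb : ∀ s t : Sched J K, (∀ j, t.num j = s.num j ∨ t.num j = 0) →
      ∀ n, bound t n ≤ bound s n) : MonoLength N := by
  rintro s t hst ⟨j, hj⟩
  have hs : 0 < s.num j := by rcases hst j with h | h <;> omega
  have h1 := (h s ⟨j, hs⟩).1
  exact (h t ⟨j, hj⟩).2 ⟨h1.1, (hb s t hst _).trans h1.2⟩

lemma IsJointEncodingLength.pos_and_mono (h : IsJointEncodingLength N) :
    PosLength N ∧ MonoLength N := by
  obtain ⟨C, M, ρ, pe, -, -, -, -, h⟩ := h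
  refine ⟨h.posLength, h.monoLength fun s t hst n => errorBound_mono C ρ ?_ ?_ n⟩
  · intro j hj
    simp only [Finset.mem_filter, Finset.mem_univ, true_and] at hj ⊢
    rcases hst j with h | h <;> omega
  · intro j hj
    simp only [Finset.mem_filter, Finset.mem_univ, true_and] at hj
    rcases hst j with h | h
    · rw [h]
    · omega

lemma IsSeparateEncodingLength.pos_and_mono (h : IsSeparateEncodingLength N) :
    PosLength N ∧ MonoLength N := by
  obtain ⟨C, M, ρ, pe, -, -, -, -, h⟩ := h
  refine ⟨h.posLength, h.monoLength fun s t hst n => errorBound_mono C ρ ?_ (fun _ _ => rfl) n⟩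
  intro i hi
  simp only [Finset.mem_filter, Finset.mem_univ, true_and] at hi ⊢
  rcases hst i.1 with h | h <;> omega

/-- Here the set of terms does not depend on the schedule; each term is monotone in the rate, since
ρ ≥ 0 and ln M_k ≥ 0. -/
lemma broadcast_errorBound_mono (C : DegradedBroadcastChannel J) {M : Fin J → ℕ}
    (hM : ∀ j, 2 ≤ M j) {ρ : ℝ} (hρ : 0 ≤ ρ) (j : Fin J) {s t : Sched J K}
    (hst : ∀ k, t.num k ≤ s.num k) (n : ℕ) :
    C.errorBound M ρ j t n ≤ C.errorBound M ρ j s n := by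
  refine Finset.sum_le_sum fun k _ => Real.exp_le_exp.2 ?_
  have hlog : 0 ≤ Real.log (M k) :=
    Real.log_nonneg (by exact_mod_cast (one_le_two.trans (hM k)))
  have hle : ρ * ((t.num k : ℝ) * Real.log (M k) / (n : ℝ)) ≤
      ρ * ((s.num k : ℝ) * Real.log (M k) / (n : ℝ)) := by
    have : (t.num k : ℝ) ≤ s.num k := by exact_mod_cast hst k
    gcongr
  have hn : (0 : ℝ) ≤ n := Nat.cast_nonneg n
  nlinarith [mul_le_mul_of_nonneg_left hle hn]

lemma IsBroadcastLength.pos_and_mono (h : IsBroadcastLength N) : PosLength N ∧ MonoLength N := by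
  obtain ⟨C, M, ρ, pe, Nj, hM, hρ, -, -, hNj, hN⟩ := h
  constructor
  · intro s j hj
    rw [hN s ⟨j, hj⟩]
    exact (hNj j s hj).1.1.trans_le (Finset.le_sup (f := fun j => Nj j s) (by simpa using hj))
  · rintro s t hst ⟨i, hi⟩
    have hpos : ∀ j, 0 < t.num j → 0 < s.num j := fun j hj => by
      rcases hst j with h | h <;> omega
    rw [hN t ⟨i, hi⟩, hN s ⟨i, hpos i hi⟩]
    refine Finset.sup_le fun j hj => ?_
    have hj' : 0 < t.num j := by simpa using hj
    have hs := (hNj j s (hpos j hj')).1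
    have hle : ∀ k, t.num k ≤ s.num k := fun k => by rcases hst k with h | h <;> omega
    refine le_trans ((hNj j t hj').2 ⟨hs.1, ?_⟩)
      (Finset.le_sup (f := fun j => Nj j s) (by simpa using hpos j hj'))
    exact (broadcast_errorBound_mono C hM hρ j hle _).trans hs.2

end Lengths

theorem mainTheorem3 {J K : ℕ} (N : Sched J K → ℕ)
    (hN : IsJointEncodingLength N ∨ IsSeparateEncodingLength N ∨ IsBroadcastLength N) :
    -- sufficient condition for regularity and stability
    (∀ (p : PMF (Sched J K)) (μ : Fin J → PMF (Sched J K)) (A : Fin J → PMF ℕ) (lam : Fin J → ℝ≥0),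
      IsSplitting μ → HasRates A lam →
      (∀ j s, InUse p μ j s →
        (N s : ℝ) * ((lam j : ℝ) * (μ j s).toReal) < (p s).toReal * (s.num j : ℝ)) →
      IsCRegularOn (queueChain N p μ A) (stateSpace N p μ) (queueCost N) ∧
        IsStableOn (queueChain N p μ A) (stateSpace N p μ) numMessages) ∧
    -- sufficient condition for transience
    (∀ (p : PMF (Sched J K)) (μ : Fin J → PMF (Sched J K)) (A : Fin J → PMF ℕ) (lam : Fin J → ℝ≥0),
      IsSplitting μ → HasRates A lam →
      (∃ j s, 0 < s.num j ∧
        (p s).toReal * (s.num j : ℝ) < (N s : ℝ) * ((lam j : ℝ) * (μ j s).toReal)) →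
      IsTransientOn (queueChain N p μ A) (stateSpace N p μ)) ∧
    -- the stability region of each policy
    (∀ p : PMF (Sched J K), stabilityRegion N p = {lam | ∀ j, (lam j : ℝ) < meanRate N p j}) ∧
    -- the union of the stability regions
    (⋃ p : PMF (Sched J K), stabilityRegion N p) = interior (outerRegion N) ∧
    -- every arrival rate vector in the interior is stabilized by some policy
    (∀ lam ∈ interior (outerRegion N), ∃ (p : PMF (Sched J K)) (μ : Fin J → PMF (Sched J K)),
      IsPolicySplitting N p μ ∧ ∀ A : Fin J → PMF ℕ, HasRates A lam →
        IsStableOn (queueChain N p μ A) (stateSpace N p μ) numMessages) := by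
  obtain ⟨hpos, hmono⟩ : PosLength N ∧ MonoLength N := by
    rcases hN with h | h | h
    · exact h.pos_and_mono
    · exact h.pos_and_mono
    · exact h.pos_and_mono
  have hunion := iUnion_stabilityRegion hpos hmono
  refine ⟨fun p μ A lam hμ hA hstab => regular_and_stable hpos hμ hA hstab,
    fun p μ A lam hμ hA ⟨j, s, _, hlt⟩ => isTransientOn_queue hpos hμ hA hlt,
    stabilityRegion_eq hpos, hunion, fun lam hlam => ?_⟩
  rw [← hunion, Set.mem_iUnion] at hlam
  obtain ⟨p, μ, hμ, hst⟩ := hlam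
  exact ⟨p, μ, hμ, hst⟩
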